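/- Let $T\in\mathbb N$, $\mathbb T=\{0,\dots,T\}$, $d\ge 1$, and let $(\Omega,\mathcal F,\mathbb P)$ be a complete probability space with a filtration $\mathbb H=(\mathcal H_t)_{t\in\mathbb T}$, $\mathcal H_T\subset\mathcal F$. Let $\mathbb M^d$ be the set of real $d\times d$ matrices, $e_{ij}$ its elementary matrices, and let $\mathcal A\subset\mathbb M^d$ be a (non-empty) closed convex cone. For a $\sigma$-algebra $\mathcal G\subset\mathcal F$, $L^0(E;\mathcal G)$ is the set of $E$-valued $\mathcal G$-measurable random variables; equalities and inequalities between random variables are understood a.s. and componentwise. Let $F=(F_t)_{t\in\mathbb T}$ be an $\mathcal F$-measurable sequence of random maps (not necessarily $\mathbb H$-adapted) such that, for each $t$, a.s. $F_t:\mathbb M^d\to\mathbb R^d$ is continuous, $F_t(\lambda a)=\lambda F_t(a)$ for $\lambda\ge 0$, $a\in\mathbb M^d$, and $F_t(\lambda a+\beta a')-(\lambda F_t(a)+\beta F_t(a'))\in\mathbb R^d_+$ for $\lambda,\beta\ge 0$, $a,a'\in\mathcal A$. Assume that $F_t(e_{ij})$ and $F_t(-e_{ij})$ are integrable for all $t,i,j$,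 and that $F$ satisfies **HA**: for all $t$, (1) $F_t(\delta e_{ij})=0$ whenever $\delta\in\{-1,1\}$ and $\delta e_{ij}\notin\mathcal A$; (2) $F_t(\eta)=\sum_{i,j\le d}\big[(\eta^{ij})^+F_t(e_{ij})+(\eta^{ij})^-F_t(-e_{ij})\big]$ for all $\eta\in L^0(\mathbb M^d;\mathcal F)$. Set $N_t(F)=\{F_t(\eta):\eta\in L^0(\mathcal A;\mathcal H_t)\}$ and $N^0_t(F)=N_t(F)\cap(-N_t(F))$; write $\xi\in N(F)$ (resp. $\xi\in N^0(F)$) if $\xi_t\in N_t(F)$ (resp. $\xi_t\in N^0_t(F)$) for all $t\in\mathbb T$. Let $V_t(\xi)=\sum_{s\le t}\xi_s$ and $A_T(F)=\{V_T(\xi)-r:\xi\in N(F),\ r\in L^0(\mathbb R^d_+;\mathcal F)\}$. Consider the conditions: **NA$^w$**: $A_T(F)\cap L^0(\mathbb R^d_+;\mathcal F)=\{0\}$. **HN$^0$**: for all $t\in\mathbb T$ and $\eta\in L^0(\mathcal A;\mathcal H_t)$, $F_t(\eta)\in N^0_t(F)$ implies $F_t(-\eta)=-F_t(\eta)$ and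 $-\eta\in L^0(\mathcal A;\mathcal H_t)$. **KP**: for all $\xi,\tilde\xi\in N(F)$, $V_T(\xi)+V_T(\tilde\xi)\in L^0(\mathbb R^d_+;\mathcal F)$ implies $\xi\in N^0(F)$ and $V_T(\xi)+V_T(\tilde\xi)=0$. Let $\mathcal D(F)$ be the set of bounded $\mathcal F$-measurable $\mathbb R^d$-valued $Z$ with $Z^i>0$ a.s. for all $i\le d$ such that, for all $t\in\mathbb T$ and $\eta_t\in L^0(\mathcal A;\mathcal H_t)$, with $\bar F_t(\eta_t;Z):=\mathbb E[Z\cdot F_t(\eta_t)\mid\mathcal H_t]$ (the generalized conditional expectation $\mathbb E[X^+\mid\mathcal H_t]-\mathbb E[X^-\mid\mathcal H_t]$ of $X=Z\cdot F_t(\eta_t)$, which need not be integrable), $$\bar F_t(\eta_t;Z)\le 0\qquad\text{and}\qquad F_t(\eta_t)\,\mathbf 1_{\{\bar F_t(\eta_t;Z)=0\}}\in N^0_t(F).$$ **Theorem.** If $\mathcal D(F)\neq\emptyset$, then NA$^w$ holds. If moreover HN$^0$ and KP hold, then NA$^w$ implies $\mathcal D(F)\neq\emptyset$. -/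

import Mathlib

open MeasureTheory
open scoped ENNReal Matrix

noncomputable section

namespace FrictionMarket

/-- `ℝᵈ`, with the componentwise order (`0 ≤ x` says that `x` lies in the positive orthant). -/
abbrev Vec (d : ℕ) : Type := Fin d → ℝ

/-- `𝕄ᵈ`, the real `d × d` matrices `(a i j)`, with the product topology and Borel `σ`-algebra. -/
abbrev Mat (d : ℕ) : Type := Fin d → Fin d → ℝ

/-- The elementary matrix `e_{ij}`. -/
def e {d : ℕ} (i j : Fin d) : Mat d := Pi.single i (Pi.single j 1)

/-- `L⁰(E; 𝒢)`: the `𝒢`-measurable random variables with values (almost surely) in `E`.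
Elements are functions; equalities between random variables are read `μ`-almost surely. -/
def L0 {Ω X : Type*} [MeasurableSpace X] {mΩ : MeasurableSpace Ω} (μ : Measure Ω)
    (E : Set X) (𝒢 : MeasurableSpace Ω) : Set (Ω → X) :=
  {η | Measurable[𝒢] η ∧ ∀ᵐ ω ∂μ, η ω ∈ E}

/-- The (generalized) conditional expectation `E[X | 𝒢] = E[X⁺ | 𝒢] - E[X⁻ | 𝒢]` of a real random
variable, where the conditional expectations of the nonnegative variables `X⁺`, `X⁻` always exist
with values in `[0, ∞]`. It is meaningful as soon as both are a.s. finite, even when `X` is not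
integrable, and it is the usual conditional expectation when `X` is integrable. -/
def genCondExp {Ω : Type*} {mΩ : MeasurableSpace Ω} (μ : Measure Ω) (𝒢 : MeasurableSpace Ω)
    (X : Ω → ℝ) : Ω → ℝ :=
  fun ω => (condLExp 𝒢 μ (fun ω' => ENNReal.ofReal (X ω')) ω).toReal
    - (condLExp 𝒢 μ (fun ω' => ENNReal.ofReal (-X ω')) ω).toReal

section Model

variable {Ω : Type*} {mΩ : MeasurableSpace Ω} {d T : ℕ}

/-- The random variable `F_t(η) : ω ↦ F_t(ω)(η(ω))`. -/
def ev (F : Fin (T + 1) → Ω → Mat d → Vec d) (t : Fin (T + 1)) (η : Ω → Mat d) : Ω → Vec d :=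
  fun ω => F t ω (η ω)

/-- The set `𝔽` of continuous maps `f : 𝕄ᵈ → ℝᵈ` that are positively homogeneous on `𝕄ᵈ` and
superadditive on the cone `𝒜`. -/
structure IsTransferMap (𝒜 : ProperCone ℝ (Mat d)) (f : Mat d → Vec d) : Prop where
  continuous : Continuous f
  homogeneous : ∀ l : ℝ, 0 ≤ l → ∀ a : Mat d, f (l • a) = l • f a
  superadditive : ∀ l b : ℝ, 0 ≤ l → 0 ≤ b → ∀ a ∈ 𝒜, ∀ a' ∈ 𝒜,
    0 ≤ f (l • a + b • a') - (l • f a + b • f a')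

/-- The class of measurable sequences `F = (F_t)_{t ≤ T}` of random maps such that `F_t` takes
a.s. values in `𝔽`, for each `t`. -/
structure IsTransferSequence (μ : Measure Ω) (𝒜 : ProperCone ℝ (Mat d))
    (F : Fin (T + 1) → Ω → Mat d → Vec d) : Prop where
  measurable : ∀ t a, Measurable fun ω => F t ω a
  transferMap : ∀ t, ∀ᵐ ω ∂μ, IsTransferMap 𝒜 (F t ω)

/-- The condition `HA`. -/
structure HA (μ : Measure Ω) (𝒜 : ProperCone ℝ (Mat d))
    (F : Fin (T + 1) → Ω → Mat d → Vec d) : Prop where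
  eq_zero_of_notMem : ∀ t i j, ∀ δ : ℝ, (δ = -1 ∨ δ = 1) → δ • e i j ∉ 𝒜 →
    ∀ᵐ ω ∂μ, F t ω (δ • e i j) = 0
  decomposition : ∀ t, ∀ η : Ω → Mat d, Measurable η → ∀ᵐ ω ∂μ,
    F t ω (η ω) = ∑ i, ∑ j, ((η ω i j)⁺ • F t ω (e i j) + (η ω i j)⁻ • F t ω (-e i j))

/-- `F_t(e_{ij})` and `F_t(-e_{ij})` are integrable. -/
def IntegrableTransfers (μ : Measure Ω) (F : Fin (T + 1) → Ω → Mat d → Vec d) : Prop :=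
  ∀ t i j, Integrable (fun ω => F t ω (e i j)) μ ∧ Integrable (fun ω => F t ω (-e i j)) μ

variable (μ : Measure Ω) (ℋ : Filtration (Fin (T + 1)) mΩ) (𝒜 : ProperCone ℝ (Mat d))
  (F : Fin (T + 1) → Ω → Mat d → Vec d)

/-- `N_t(F) = {F_t(η) : η ∈ L⁰(𝒜; ℋ_t)}`. -/
def N (t : Fin (T + 1)) : Set (Ω → Vec d) :=
  {ξ | ∃ η ∈ L0 μ (𝒜 : Set (Mat d)) (ℋ t), ξ =ᵐ[μ] ev F t η}

/-- `N⁰_t(F) = N_t(F) ∩ (-N_t(F))`, the reversible exchanges at time `t`. -/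
def N0 (t : Fin (T + 1)) : Set (Ω → Vec d) :=
  {ξ | ξ ∈ N μ ℋ 𝒜 F t ∧ -ξ ∈ N μ ℋ 𝒜 F t}

/-- `V_t(ξ) = ∑_{s ≤ t} ξ_s`. -/
def V (t : Fin (T + 1)) (ξ : Fin (T + 1) → Ω → Vec d) : Ω → Vec d :=
  ∑ s ∈ Finset.Iic t, ξ s

/-- `L⁰(ℝᵈ₊; ℱ)`. -/
def L0Pos : Set (Ω → Vec d) := L0 μ {x : Vec d | 0 ≤ x} mΩ

/-- `A_t(F) = {V_t(ξ) - r : ξ ∈ N(F), r ∈ L⁰(ℝᵈ₊; ℱ)}`. -/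
def A (t : Fin (T + 1)) : Set (Ω → Vec d) :=
  {g | ∃ ξ : Fin (T + 1) → Ω → Vec d, (∀ s, ξ s ∈ N μ ℋ 𝒜 F s) ∧
    ∃ r ∈ L0Pos (d := d) μ, g =ᵐ[μ] V t ξ - r}

/-- The condition `KP`. -/
def KP : Prop :=
  ∀ ξ ξ' : Fin (T + 1) → Ω → Vec d,
    (∀ t, ξ t ∈ N μ ℋ 𝒜 F t) → (∀ t, ξ' t ∈ N μ ℋ 𝒜 F t) →
    V (Fin.last T) ξ + V (Fin.last T) ξ' ∈ L0Pos (d := d) μ →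
    (∀ t, ξ t ∈ N0 μ ℋ 𝒜 F t) ∧ V (Fin.last T) ξ + V (Fin.last T) ξ' =ᵐ[μ] 0

/-- The condition `HN⁰`. -/
def HN0 : Prop :=
  ∀ t, ∀ η ∈ L0 μ (𝒜 : Set (Mat d)) (ℋ t), ev F t η ∈ N0 μ ℋ 𝒜 F t →
    ev F t (-η) =ᵐ[μ] -ev F t η ∧ -η ∈ L0 μ (𝒜 : Set (Mat d)) (ℋ t)

/-- Weak no-arbitrage: `A_T(F) ∩ L⁰(ℝᵈ₊; ℱ) = {0}`. -/
def NAw : Prop :=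
  A μ ℋ 𝒜 F (Fin.last T) ∩ L0Pos (d := d) μ = {g | g =ᵐ[μ] 0}

/-- `F̄_t(η; Z) = E[Z · F_t(η) | ℋ_t]`. -/
def Fbar (t : Fin (T + 1)) (η : Ω → Mat d) (Z : Ω → Vec d) : Ω → ℝ :=
  genCondExp μ (ℋ t) fun ω => Z ω ⬝ᵥ ev F t η ω

/-- The dual set `𝒟(F)`: bounded `Z` with a.s. positive components such that, for every `t` and
every `η ∈ L⁰(𝒜; ℋ_t)`, `F̄_t(η; Z) ≤ 0` and `F_t(η) 1_{F̄_t(η; Z) = 0} ∈ N⁰_t(F)`. -/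
structure IsDual (Z : Ω → Vec d) : Prop where
  measurable : Measurable Z
  bounded : MemLp Z ∞ μ
  pos : ∀ i, ∀ᵐ ω ∂μ, 0 < Z ω i
  nonpos : ∀ t, ∀ η ∈ L0 μ (𝒜 : Set (Mat d)) (ℋ t), ∀ᵐ ω ∂μ, Fbar μ ℋ F t η Z ω ≤ 0
  reversible : ∀ t, ∀ η ∈ L0 μ (𝒜 : Set (Mat d)) (ℋ t),
    Set.indicator {ω | Fbar μ ℋ F t η Z ω = 0} (ev F t η) ∈ N0 μ ℋ 𝒜 F t

def dualSet : Set (Ω → Vec d) := {Z | IsDual μ ℋ 𝒜 F Z}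

end Model

end FrictionMarket

end

namespace FrictionMarket

open Filter Topology

/-! ### Measurable random subsequences. -/

section Selection

/-! A dual variable `Z` acts as a consistent price. If a strategy has nonnegative terminal value,
then the sum of the `Z · F_t(η_t)` is a nonnegative sum of terms with conditional expectation at
most zero, so it vanishes; positivity of the components of `Z` then makes the terminal value vanish.
The terms need be neither integrable nor adapted, so `sum_eq_zero_of_condExp_nonpos` splits off the
sizes `1 + ‖η_t‖` and inducts on the number of dates.

For the converse, let K be the set `attainableFrom μ ℋ 𝒜 F 0` of superreplicable claims. It is a
convex cone by superadditivity and homogeneity, and `aeSeqClosed_attainableFrom` shows that it is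
closed under a.s. convergence. Where positions explode, their normalised limit is a trade that later
dates can offset. KP makes this round trip reversible and worthless, and HN⁰ allows any multiple of
it to be subtracted, which removes one matrix entry from the positions; finitely many removals
suffice. By Hahn–Banach in `L¹`, every integrable claim outside K is then separated from K by an
element of `unitPolar`.

A single `Z` must do the work of all these separating elements. Exhaustion gives one
(`exists_maximal_mem_unitPolar`) for which the supports of the components and the events of strictly
negative conditional value are largest. HA makes the conditional value an explicit continuous
function of the matrix (`dualValue`), so countably many balls test strict negativity for all random
`η` at once. Where the maximal `Z` values a bounded trade at zero, so does every element of the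
polar; hence the negative of that trade cannot be separated from K, lies in K, and KP makes the
trade reversible. In the same way, a unit claim carried by `{Zⁱ ≤ 0}` lies in K, and KP forces it to
vanish. -/

theorem measurable_apply_nat {Ω X : Type*} {m : MeasurableSpace Ω} [MeasurableSpace X]
    {f : ℕ → Ω → X} (hf : ∀ n, Measurable (f n)) {τ : Ω → ℕ} (hτ : Measurable τ) :
    Measurable fun ω => f (τ ω) ω :=
  (measurable_from_prod_countable_right (f := fun p : ℕ × Ω => f p.1 p.2) hf).comp
    (hτ.prodMk measurable_id)

/-- A bounded sequence of real random variables converges along a measurable random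
subsequence. -/
theorem exists_measurable_subseq_real {Ω : Type*} {m : MeasurableSpace Ω} (x : ℕ → Ω → ℝ)
    (hx : ∀ n, Measurable (x n)) (hb : ∀ n ω, |x n ω| ≤ 1) :
    ∃ (τ : ℕ → Ω → ℕ) (y : Ω → ℝ), (∀ k, Measurable (τ k)) ∧ (∀ k ω, k ≤ τ k ω) ∧
      Measurable y ∧ ∀ ω, Tendsto (fun k => x (τ k ω) ω) atTop (𝓝 (y ω)) := by
  classical
  set y : Ω → ℝ := fun ω => limsup (fun n => x n ω) atTop with hy
  have hym : Measurable y := Measurable.limsup hx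
  have hfreq : ∀ ω (k : ℕ), ∃ n, k ≤ n ∧ |x n ω - y ω| ≤ 1 / ((k : ℝ) + 1) := by
    intro ω k
    have hpos : (0 : ℝ) < 1 / ((k : ℝ) + 1) := by positivity
    have hbd : IsBoundedUnder (· ≤ ·) atTop (fun n => x n ω) :=
      isBoundedUnder_of ⟨1, fun n => (abs_le.1 (hb n ω)).2⟩
    have hbd' : IsBoundedUnder (· ≥ ·) atTop (fun n => x n ω) :=
      isBoundedUnder_of ⟨-1, fun n => (abs_le.1 (hb n ω)).1⟩
    have h1 : ∀ᶠ n in atTop, x n ω < y ω + 1 / ((k : ℝ) + 1) :=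
      eventually_lt_of_limsup_lt (by simp only [hy] at *; linarith) hbd
    have h2 : ∃ᶠ n in atTop, y ω - 1 / ((k : ℝ) + 1) < x n ω :=
      frequently_lt_of_lt_limsup hbd'.isCoboundedUnder_le (by simp only [hy] at *; linarith)
    obtain ⟨n, hn1, hn2, hn3⟩ := (h2.and_eventually (h1.and (eventually_ge_atTop k))).exists
    exact ⟨n, hn3, abs_le.2 ⟨by linarith, by linarith⟩⟩
  -- Taking the least admissible index close to the limsup makes the choice measurable in `ω`.
  refine ⟨fun k ω => Nat.find (hfreq ω k), y, fun k => ?_, fun k ω => (Nat.find_spec (hfreq ω k)).1,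
    hym, fun ω => ?_⟩
  · refine measurable_find _ fun n => ?_
    refine (MeasurableSet.const _).inter ?_
    exact measurableSet_le ((hx n).sub hym).norm measurable_const
  · rw [tendsto_iff_dist_tendsto_zero]
    refine squeeze_zero (fun _ => dist_nonneg) (fun k => (Nat.find_spec (hfreq ω k)).2)
      tendsto_one_div_add_atTop_nhds_zero_nat

theorem exists_measurable_subseq_finset {Ω ι : Type*} {m : MeasurableSpace Ω} (x : ℕ → Ω → ι → ℝ)
    (hx : ∀ n i, Measurable fun ω => x n ω i) (hb : ∀ n ω i, |x n ω i| ≤ 1) (S : Finset ι) :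
    ∃ (τ : ℕ → Ω → ℕ) (y : Ω → ι → ℝ), (∀ k, Measurable (τ k)) ∧ (∀ k ω, k ≤ τ k ω) ∧
      (∀ i, Measurable fun ω => y ω i) ∧
      ∀ ω, ∀ i ∈ S, Tendsto (fun k => x (τ k ω) ω i) atTop (𝓝 (y ω i)) := by
  classical
  induction S using Finset.induction_on with
  | empty =>
    exact ⟨fun k _ => k, fun _ _ => 0, fun k => measurable_const, fun k ω => le_rfl,
      fun i => measurable_const, by simp⟩
  | insert p S _ ih =>
    obtain ⟨τ, y, hτ, hτk, hy, hlim⟩ := ih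
    obtain ⟨σ, z, hσ, hσk, hz, hlim'⟩ := exists_measurable_subseq_real
      (fun k ω => x (τ k ω) ω p)
      (fun k => measurable_apply_nat (f := fun n ω => x n ω p) (fun n => hx n p) (hτ k))
      (fun k ω => hb _ _ _)
    refine ⟨fun k ω => τ (σ k ω) ω, fun ω => Function.update (y ω) p (z ω),
      fun k => measurable_apply_nat hτ (hσ k), fun k ω => (hσk k ω).trans (hτk _ _), fun i => ?_,
      fun ω i hi => ?_⟩
    · by_cases h : i = p
      · subst h; simpa using hz
      · simpa [h] using hy i
    · dsimp only
      by_cases h : i = p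
      · subst h; simpa using hlim' ω
      · rw [Function.update_of_ne h]
        exact (hlim ω i (Finset.mem_of_mem_insert_of_ne hi h)).comp
          (tendsto_atTop_mono (hσk · ω) tendsto_id)

theorem exists_measurable_subseq {Ω ι : Type*} [Fintype ι] {m : MeasurableSpace Ω}
    (x : ℕ → Ω → ι → ℝ)
    (hx : ∀ n i, Measurable fun ω => x n ω i) (hb : ∀ n ω i, |x n ω i| ≤ 1) :
    ∃ (τ : ℕ → Ω → ℕ) (y : Ω → ι → ℝ), (∀ k, Measurable (τ k)) ∧ (∀ k ω, k ≤ τ k ω) ∧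
      (∀ i, Measurable fun ω => y ω i) ∧
      ∀ ω i, Tendsto (fun k => x (τ k ω) ω i) atTop (𝓝 (y ω i)) := by
  obtain ⟨τ, y, h1, h2, h3, h4⟩ := exists_measurable_subseq_finset x hx hb Finset.univ
  exact ⟨τ, y, h1, h2, h3, fun ω i => h4 ω i (Finset.mem_univ i)⟩

end Selection

/-! ### Essentially maximal families of events. -/

section Exhaustion

/-- Exhaustion: if countably many elements can always be dominated simultaneously, then there is
an element whose associated events are all maximal. -/
theorem exists_forall_ae_le_of_dominated {Ω α ι : Type*} {mΩ : MeasurableSpace Ω} {μ : Measure Ω}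
    [IsFiniteMeasure μ] [Nonempty α] [Countable ι] (B : ι → α → Set Ω)
    (hB : ∀ q a, MeasurableSet (B q a))
    (hdom : ∀ f : ℕ → α, ∃ a, ∀ n q, B q (f n) ≤ᵐ[μ] B q a) :
    ∃ a, ∀ q b, B q b ≤ᵐ[μ] B q a := by
  have hseq : ∀ q, ∃ f : ℕ → α, Tendsto (fun n => μ (B q (f n))) atTop (𝓝 (⨆ a, μ (B q a))) := by
    intro q
    obtain ⟨u, -, hu, hmem⟩ := exists_seq_tendsto_sSup (S := Set.range fun a => μ (B q a))
      (Set.range_nonempty _) (OrderTop.bddAbove _)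
    choose f hf using hmem
    exact ⟨f, by simp only [hf]; exact hu⟩
  choose f hf using hseq
  rcases isEmpty_or_nonempty ι with hι | hι
  · exact ⟨Classical.arbitrary α, fun q => hι.elim q⟩
  obtain ⟨g, hg⟩ := exists_surjective_nat (ι × ℕ)
  obtain ⟨a, ha⟩ := hdom fun n => f (g n).1 (g n).2
  have hmax : ∀ q, ⨆ b, μ (B q b) ≤ μ (B q a) := by
    intro q
    refine le_of_tendsto' (hf q) fun n => ?_
    obtain ⟨k, hk⟩ := hg (q, n)
    have := ha k q
    rw [hk] at this
    exact measure_mono_ae this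
  refine ⟨a, fun q b => ?_⟩
  -- Dominate `a` and `b` together by `c`: the event of `c` contains that of `a` and cannot have
  -- larger measure, so the two agree a.e.
  obtain ⟨c, hc⟩ := hdom fun n => if n = 0 then a else b
  have h0 : B q a ≤ᵐ[μ] B q c := by simpa using hc 0 q
  have h1 : B q b ≤ᵐ[μ] B q c := by simpa using hc 1 q
  have : B q a =ᵐ[μ] B q c := ae_eq_of_ae_subset_of_measure_ge h0
    ((le_iSup (fun b => μ (B q b)) c).trans (hmax q)) (hB q a).nullMeasurableSet
    (measure_ne_top _ _)
  exact h1.trans this.symm.le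

end Exhaustion

/-! ### Generalized conditional expectations and supermartingale increments. -/

section Conditional

variable {Ω : Type*} {mΩ : MeasurableSpace Ω} {μ : Measure Ω}

theorem genCondExp_of_integrable {m : MeasurableSpace Ω} {X : Ω → ℝ} (hX : Integrable X μ) :
    genCondExp μ m X =ᵐ[μ] μ[X | m] := by
  have hpart : ∀ Y : Ω → ℝ, Integrable Y μ →
      (fun ω => (condLExp m μ (fun ω => ENNReal.ofReal (Y ω)) ω).toReal) =ᵐ[μ]
        μ[fun ω => Y ω ⊔ 0 | m] := by
    intro Y hY
    refine (toReal_condLExp m hY.1.aemeasurable.ennreal_ofReal ?_).trans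
      (condExp_congr_ae (Eq.eventuallyEq ?_))
    · exact hY.lintegral_lt_top.ne
    · funext ω; exact ENNReal.toReal_ofReal'
  have hsub := condExp_sub (μ := μ) hX.pos_part hX.neg_part m
  filter_upwards [hpart X hX, hpart (fun ω => -X ω) hX.neg, hsub] with ω h1 h2 h3
  simp only [genCondExp, h1, h2]
  rw [Pi.sub_apply] at h3
  rw [← h3]
  congr 2
  funext ω
  simp only [Pi.sub_apply]
  rcases le_total 0 (X ω) with h | h <;> simp [h]

variable [IsFiniteMeasure μ]

/-- The densities `f` and `condLExp m μ f` induce the same measure on `m`, so every `m`-measurable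
`c` has the same integral against both. -/
theorem condLExp_mul_left {m : MeasurableSpace Ω} (hm : m ≤ mΩ) {c f : Ω → ℝ≥0∞}
    (hc : Measurable[m] c) (hf : AEMeasurable f μ) :
    condLExp m μ (c * f) =ᵐ[μ] c * condLExp m μ f := by
  refine (ae_eq_condLExp hm μ (c * f) (hc.mul (measurable_condLExp m μ f)) fun s hs => ?_).symm
  have htrim : (μ.withDensity (condLExp m μ f)).trim hm = (μ.withDensity f).trim hm := by
    refine @Measure.ext _ m _ _ fun u hu => ?_
    rw [trim_measurableSet_eq hm hu, trim_measurableSet_eq hm hu, withDensity_apply _ (hm _ hu),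
      withDensity_apply _ (hm _ hu), setLIntegral_condLExp hm μ f hu]
  have key : ∀ g : Ω → ℝ≥0∞, AEMeasurable g μ →
      ∫⁻ ω in s, (c * g) ω ∂μ = ∫⁻ ω, s.indicator c ω ∂((μ.withDensity g).trim hm) := by
    intro g hg
    rw [lintegral_trim hm (hc.indicator hs), lintegral_withDensity_eq_lintegral_mul₀ hg
      ((hc.indicator hs).mono hm le_rfl).aemeasurable, ← lintegral_indicator (hm _ hs)]
    refine lintegral_congr fun ω => ?_
    by_cases h : ω ∈ s <;> simp [h, mul_comm]
  rw [key f hf, key _ (measurable_condLExp' m μ f).aemeasurable, htrim]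

theorem genCondExp_mul_left {m : MeasurableSpace Ω} (hm : m ≤ mΩ) {c X : Ω → ℝ}
    (hc : Measurable[m] c) (hc0 : 0 ≤ c) (hX : AEMeasurable X μ) :
    genCondExp μ m (fun ω => c ω * X ω) =ᵐ[μ] fun ω => c ω * genCondExp μ m X ω := by
  have key : ∀ Y : Ω → ℝ, AEMeasurable Y μ →
      condLExp m μ (fun ω => ENNReal.ofReal (c ω * Y ω)) =ᵐ[μ]
        fun ω => ENNReal.ofReal (c ω) * condLExp m μ (fun ω => ENNReal.ofReal (Y ω)) ω := by
    intro Y hY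
    have := condLExp_mul_left (μ := μ) hm (c := fun ω => ENNReal.ofReal (c ω))
      (f := fun ω => ENNReal.ofReal (Y ω)) hc.ennreal_ofReal hY.ennreal_ofReal
    refine EventuallyEq.trans (Eq.eventuallyEq ?_) this
    congr 1
    funext ω
    exact ENNReal.ofReal_mul (hc0 ω)
  filter_upwards [key X hX, key (fun ω => -X ω) hX.neg] with ω h1 h2
  simp only [genCondExp, ← mul_neg, h1, h2, ENNReal.toReal_mul, ENNReal.toReal_ofReal (hc0 ω)]
  ring

/-- Nonnegative terminal sums of generalized supermartingale increments vanish. The increments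
`b t * Y t` are not assumed integrable nor adapted. -/
theorem sum_eq_zero_of_condExp_nonpos {m : ℕ → MeasurableSpace Ω} (hmono : Monotone m)
    (hm : ∀ n, m n ≤ mΩ) (n : ℕ) (b Y : ℕ → Ω → ℝ) (hb : ∀ t, Measurable[m t] (b t))
    (hb1 : ∀ t ω, 1 ≤ b t ω) (hY : ∀ t, Integrable (Y t) μ)
    (hcond : ∀ t, μ[Y t | m t] ≤ᵐ[μ] 0)
    (hpos : ∀ᵐ ω ∂μ, 0 ≤ ∑ t ∈ Finset.range n, b t ω * Y t ω) :
    ∀ᵐ ω ∂μ, ∑ t ∈ Finset.range n, b t ω * Y t ω = 0 := by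
  induction n generalizing Y with
  | zero => simp
  | succ n ih =>
    -- Dividing by the product of all sizes, which is known at the last date, turns every
    -- coefficient into one bounded by `1` without changing the sign of the sum.
    set c : Ω → ℝ := fun ω => (∏ t ∈ Finset.range (n + 1), b t ω)⁻¹ with hc
    have hprod1 : ∀ ω, ∀ S : Finset ℕ, 1 ≤ ∏ t ∈ S, b t ω := fun ω S =>
      Finset.prod_induction _ (1 ≤ ·) (fun _ _ => one_le_mul_of_one_le_of_one_le) le_rfl
        fun t _ => hb1 t ω
    have hcpos : ∀ ω, 0 < c ω := fun ω => inv_pos.2 (one_pos.trans_le (hprod1 ω _))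
    have hbn : ∀ t ∈ Finset.range (n + 1), Measurable[m n] (b t) := fun t ht =>
      (hb t).mono (hmono (Nat.lt_succ_iff.1 (Finset.mem_range.1 ht))) le_rfl
    have hcm : Measurable[m n] c := (Finset.measurable_fun_prod _ hbn).inv
    have hcb : ∀ t ∈ Finset.range (n + 1), ∀ ω, |c ω * b t ω| ≤ 1 := by
      intro t ht ω
      have h1 := hb1 t ω
      rw [abs_of_nonneg (mul_nonneg (hcpos ω).le (by linarith)), hc]
      simp only
      rw [← Finset.mul_prod_erase _ _ ht, mul_inv, mul_comm, ← mul_assoc,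
        mul_inv_cancel₀ (by positivity), one_mul]
      exact inv_le_one_of_one_le₀ (hprod1 ω _)
    have hint : ∀ t ∈ Finset.range (n + 1), Integrable (fun ω => c ω * b t ω * Y t ω) μ := by
      intro t ht
      refine (hY t).bdd_mul (c := 1)
        ((hcm.mul (hbn t ht)).mono (hm n) le_rfl).aestronglyMeasurable ?_
      exact Eventually.of_forall fun ω => hcb t ht ω
    have hpull : ∀ t ∈ Finset.range (n + 1), μ[fun ω => c ω * b t ω * Y t ω | m n] =ᵐ[μ]
        fun ω => c ω * b t ω * (μ[Y t | m n]) ω := fun t ht =>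
      condExp_mul_of_stronglyMeasurable_left (f := fun ω => c ω * b t ω) (g := Y t)
        (hcm.mul (hbn t ht)).stronglyMeasurable (hint t ht) (hY t)
    set S : Ω → ℝ := fun ω => ∑ t ∈ Finset.range (n + 1), c ω * b t ω * Y t ω with hS
    have hSeq : ∀ ω, S ω = c ω * ∑ t ∈ Finset.range (n + 1), b t ω * Y t ω := fun ω => by
      simp only [hS, Finset.mul_sum, mul_assoc]
    have hS0 : 0 ≤ᵐ[μ] S := by
      filter_upwards [hpos] with ω h
      rw [hSeq]
      exact mul_nonneg (hcpos ω).le h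
    have hSint : Integrable S μ := integrable_finsetSum _ hint
    have hScond : μ[S | m n] =ᵐ[μ]
        fun ω => c ω * ∑ t ∈ Finset.range (n + 1), b t ω * (μ[Y t | m n]) ω := by
      have h1 : μ[S | m n] =ᵐ[μ]
          ∑ t ∈ Finset.range (n + 1), μ[fun ω => c ω * b t ω * Y t ω | m n] := by
        have := condExp_finsetSum (μ := μ) hint (m n)
        refine EventuallyEq.trans (Eq.eventuallyEq ?_) this
        congr 1
        funext ω
        simp [hS]
      have h2 : ∀ᵐ ω ∂μ, ∀ t ∈ Finset.range (n + 1), (μ[fun ω => c ω * b t ω * Y t ω | m n]) ω =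
          c ω * b t ω * (μ[Y t | m n]) ω :=
        (Finset.eventually_all _).2 hpull
      filter_upwards [h1, h2] with ω h1 h2
      rw [h1, Finset.sum_apply, Finset.sum_congr rfl h2, Finset.mul_sum]
      simp only [mul_assoc]
    have hScond0 : 0 ≤ᵐ[μ] μ[S | m n] := condExp_nonneg hS0
    -- Induct on the projections of the earlier terms to `m n`: the tower property preserves their
    -- sign conditions. Indices above `n` never enter the sum and keep `Y t` so that the hypotheses
    -- hold for all indices.
    have hih := ih (fun t => if t ≤ n then μ[Y t | m n] else Y t) (fun t => by
        split_ifs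
        · exact integrable_condExp
        · exact hY t) (fun t => by
        split_ifs with h
        · exact (condExp_condExp_of_le (hmono h) (hm n)).le.trans (hcond t)
        · exact hcond t) ?_
    · have hS' : μ[S | m n] ≤ᵐ[μ] 0 := by
        filter_upwards [hScond, hih, hcond n] with ω h1 h2 h3
        rw [h1, Finset.sum_range_succ]
        have : ∑ t ∈ Finset.range n, b t ω * (μ[Y t | m n]) ω = 0 := by
          rw [← h2]
          exact Finset.sum_congr rfl fun t ht => by rw [if_pos (Finset.mem_range.1 ht).le]
        rw [this, zero_add]
        exact mul_nonpos_of_nonneg_of_nonpos (hcpos ω).le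
          (mul_nonpos_of_nonneg_of_nonpos (by linarith [hb1 n ω]) h3)
      have hz : ∫ ω, S ω ∂μ = 0 := by
        refine le_antisymm ?_ (integral_nonneg_of_ae hS0)
        rw [← integral_condExp (hm n)]
        exact integral_nonpos_of_ae hS'
      filter_upwards [(integral_eq_zero_iff_of_nonneg_ae hS0 hSint).1 hz] with ω h
      have h' : c ω * ∑ t ∈ Finset.range (n + 1), b t ω * Y t ω = 0 := by rw [← hSeq]; exact h
      exact (mul_eq_zero.1 h').resolve_left (hcpos ω).ne'
    · filter_upwards [hScond, hScond0, hcond n] with ω h1 h2 h3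
      rw [h1, Finset.sum_range_succ] at h2
      have h4 : 0 ≤ ∑ t ∈ Finset.range n, b t ω * (μ[Y t | m n]) ω + b n ω * (μ[Y n | m n]) ω :=
        le_of_mul_le_mul_left (by simpa using h2) (hcpos ω)
      have h5 : b n ω * (μ[Y n | m n]) ω ≤ 0 :=
        mul_nonpos_of_nonneg_of_nonpos (by linarith [hb1 n ω]) h3
      have : ∑ t ∈ Finset.range n, b t ω * (if t ≤ n then μ[Y t | m n] else Y t) ω =
          ∑ t ∈ Finset.range n, b t ω * (μ[Y t | m n]) ω :=
        Finset.sum_congr rfl fun t ht => by rw [if_pos (Finset.mem_range.1 ht).le]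
      rw [this]
      linarith

end Conditional

/-! ### Representation of functionals on `L¹` by bounded functions. -/

section Duality

variable {Ω : Type*} {mΩ : MeasurableSpace Ω} {μ : Measure Ω} [IsFiniteMeasure μ]

/-- Every continuous linear functional on `L¹(μ; ℝ)` is represented by a bounded function. -/
theorem exists_bounded_repr_real (φ : Lp ℝ 1 μ →L[ℝ] ℝ) :
    ∃ Z : Ω → ℝ, Measurable Z ∧ (∃ C, ∀ ω, |Z ω| ≤ C) ∧ ∀ f, φ f = ∫ ω, Z ω * f ω ∂μ := by
  classical
  let one : Lp ℝ 2 μ := indicatorConstLp 2 MeasurableSet.univ (measure_ne_top μ _) 1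
  -- The inclusion of `L²` in `L¹`, as Hölder multiplication by the constant `1`; it reduces the
  -- representation to Riesz in `L²`.
  let incl : Lp ℝ 2 μ →L[ℝ] Lp ℝ 1 μ :=
    (ContinuousLinearMap.mul ℝ ℝ).holderL μ 2 2 1 one
  have hincl : ∀ (B : Set Ω) (hB : MeasurableSet B),
      incl (indicatorConstLp 2 hB (measure_ne_top μ _) 1) =
        indicatorConstLp 1 hB (measure_ne_top μ _) 1 := by
    intro B hB
    refine Lp.ext ?_
    have h1 := (ContinuousLinearMap.mul ℝ ℝ).coeFn_holder (r := 1) one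
      (indicatorConstLp 2 hB (measure_ne_top μ _) 1)
    have h2 : one =ᵐ[μ] Set.univ.indicator fun _ => (1 : ℝ) := indicatorConstLp_coeFn
    have h3 : (indicatorConstLp 2 hB (measure_ne_top μ _) (1 : ℝ) : Lp ℝ 2 μ) =ᵐ[μ]
      B.indicator fun _ => (1 : ℝ) := indicatorConstLp_coeFn
    have h4 : (indicatorConstLp 1 hB (measure_ne_top μ _) (1 : ℝ) : Lp ℝ 1 μ) =ᵐ[μ]
      B.indicator fun _ => (1 : ℝ) := indicatorConstLp_coeFn
    filter_upwards [h1, h2, h3, h4] with ω h1 h2 h3 h4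
    rw [h4, show incl _ = (ContinuousLinearMap.mul ℝ ℝ).holder 1 one _ from rfl, h1, h2, h3]
    simp
  let z : Lp ℝ 2 μ := (InnerProductSpace.toDual ℝ (Lp ℝ 2 μ)).symm (φ.comp incl)
  have hzint : Integrable z μ := (Lp.memLp z).integrable one_le_two
  have hz : ∀ (B : Set Ω) (hB : MeasurableSet B),
      φ (indicatorConstLp 1 hB (measure_ne_top μ _) 1) = ∫ ω in B, z ω ∂μ := by
    intro B hB
    have h1 : inner ℝ z (indicatorConstLp 2 hB (measure_ne_top μ _) 1) =
        φ (incl (indicatorConstLp 2 hB (measure_ne_top μ _) 1)) :=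
      InnerProductSpace.toDual_symm_apply
    rw [← hincl B hB, ← h1, real_inner_comm, L2.inner_indicatorConstLp_one]
  have hbound : ∀ B : Set Ω, MeasurableSet B → |∫ ω in B, z ω ∂μ| ≤ ‖φ‖ * μ.real B := by
    intro B hB
    rw [← hz B hB, ← Real.norm_eq_abs]
    refine (φ.le_opNorm _).trans ?_
    rw [norm_indicatorConstLp one_ne_zero ENNReal.one_ne_top]
    simp
  have hle : z ≤ᵐ[μ] fun _ => ‖φ‖ := by
    refine ae_le_of_forall_setIntegral_le hzint (integrable_const _) fun B hB _ => ?_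
    rw [setIntegral_const, smul_eq_mul, mul_comm]
    exact (le_abs_self _).trans (hbound B hB)
  have hge : (fun _ => -‖φ‖) ≤ᵐ[μ] z := by
    refine ae_le_of_forall_setIntegral_le (integrable_const _) hzint fun B hB _ => ?_
    rw [setIntegral_const, smul_eq_mul, mul_comm, neg_mul]
    exact neg_le.1 ((neg_le_abs _).trans (hbound B hB))
  have hzm : Measurable z := (Lp.stronglyMeasurable z).measurable
  -- The averages of `z` over events are bounded by `‖φ‖`, so this truncation changes `z` only on a
  -- null set and gives a bound at every point.
  set Z : Ω → ℝ := fun ω => if |z ω| ≤ ‖φ‖ then z ω else 0 with hZ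
  have hZz : Z =ᵐ[μ] z := by
    filter_upwards [hle, hge] with ω h1 h2
    simp only [hZ]
    rw [if_pos (abs_le.2 ⟨h2, h1⟩)]
  have hZm : Measurable Z :=
    Measurable.ite (measurableSet_le hzm.norm measurable_const) hzm measurable_const
  have hZb : ∀ ω, |Z ω| ≤ ‖φ‖ := by
    intro ω
    simp only [hZ]
    split_ifs with h
    · exact h
    · simp
  have hint : ∀ f : Lp ℝ 1 μ, Integrable (fun ω => Z ω * f ω) μ := fun f =>
    (L1.integrable_coeFn f).bdd_mul (c := ‖φ‖) hZm.aestronglyMeasurable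
      (Eventually.of_forall hZb)
  refine ⟨Z, hZm, ⟨_, hZb⟩, fun f => ?_⟩
  let ψ : Lp ℝ 1 μ →L[ℝ] ℝ := LinearMap.mkContinuous
    { toFun := fun f => ∫ ω, Z ω * f ω ∂μ
      map_add' := fun f g => by
        rw [← integral_add (hint f) (hint g)]
        refine integral_congr_ae ?_
        filter_upwards [Lp.coeFn_add f g] with ω h
        rw [h, Pi.add_apply, mul_add]
      map_smul' := fun r f => by
        rw [RingHom.id_apply, smul_eq_mul, ← integral_const_mul]
        refine integral_congr_ae ?_
        filter_upwards [Lp.coeFn_smul r f] with ω h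
        rw [h, Pi.smul_apply, smul_eq_mul]
        ring } ‖φ‖ (fun f => by
      refine (norm_integral_le_integral_norm _).trans ?_
      rw [L1.norm_eq_integral_norm, ← integral_const_mul]
      refine integral_mono (hint f).norm ((L1.integrable_coeFn f).norm.const_mul _) fun ω => ?_
      simp only [norm_mul]
      exact mul_le_mul_of_nonneg_right (hZb ω) (norm_nonneg _))
  change φ f = ψ f
  induction f using Lp.induction (p := 1) ENNReal.one_ne_top with
  | indicatorConst c hB hμ =>
    rename_i B
    have hc : (Lp.simpleFunc.indicatorConst 1 hB hμ.ne c : Lp ℝ 1 μ) =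
        c • indicatorConstLp 1 hB (measure_ne_top μ _) (1 : ℝ) := by
      rw [Lp.simpleFunc.coe_indicatorConst]
      refine Lp.ext ?_
      filter_upwards [indicatorConstLp_coeFn (p := 1) (hs := hB) (hμs := hμ.ne) (c := c),
        Lp.coeFn_smul c (indicatorConstLp 1 hB (measure_ne_top μ _) (1 : ℝ)),
        indicatorConstLp_coeFn (p := 1) (hs := hB) (hμs := measure_ne_top μ _) (c := (1 : ℝ))]
        with ω h1 h2 h3
      rw [h1, h2, Pi.smul_apply, h3]
      by_cases h : ω ∈ B <;> simp [h]
    rw [hc, map_smul, map_smul, hz B hB]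
    congr 1
    change _ = ∫ ω, Z ω * _ ∂μ
    rw [← integral_indicator hB]
    refine integral_congr_ae ?_
    have h3 : (indicatorConstLp 1 hB (measure_ne_top μ _) (1 : ℝ) : Lp ℝ 1 μ) =ᵐ[μ]
      B.indicator fun _ => (1 : ℝ) := indicatorConstLp_coeFn
    filter_upwards [h3, hZz] with ω h3 h4
    rw [h3, h4]
    by_cases h : ω ∈ B <;> simp [h]
  | @add f g hf hg _ h1 h2 => rw [map_add, map_add, h1, h2]
  | isClosed => exact isClosed_eq φ.continuous ψ.continuous

/-- Split a vector-valued function into its coordinates and represent the functional on each of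
them. -/
theorem exists_bounded_repr {d : ℕ} (φ : Lp (Vec d) 1 μ →L[ℝ] ℝ) :
    ∃ Z : Ω → Vec d, Measurable Z ∧ (∃ C, ∀ ω i, |Z ω i| ≤ C) ∧
      ∀ f, φ f = ∫ ω, Z ω ⬝ᵥ f ω ∂μ := by
  classical
  let ι : Fin d → Lp ℝ 1 μ →L[ℝ] Lp (Vec d) 1 μ := fun i =>
    (ContinuousLinearMap.single ℝ (fun _ : Fin d => ℝ) i).compLpL 1 μ
  let π : Fin d → Lp (Vec d) 1 μ →L[ℝ] Lp ℝ 1 μ := fun i =>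
    (ContinuousLinearMap.proj (R := ℝ) (φ := fun _ : Fin d => ℝ) i).compLpL 1 μ
  choose Z hZm hZb hZ using fun i => exists_bounded_repr_real (φ.comp (ι i))
  choose C hC using hZb
  have hπ : ∀ i (f : Lp (Vec d) 1 μ), π i f =ᵐ[μ] fun ω => f ω i := fun i f =>
    (ContinuousLinearMap.proj (R := ℝ) (φ := fun _ : Fin d => ℝ) i).coeFn_compLpL f
  refine ⟨fun ω i => Z i ω, measurable_pi_lambda _ hZm, ⟨∑ i, |C i|, fun ω i =>
    ((hC i ω).trans (le_abs_self _)).trans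
      (Finset.single_le_sum (f := fun i => |C i|) (fun _ _ => abs_nonneg _)
        (Finset.mem_univ i))⟩, fun f => ?_⟩
  have hsum : f = ∑ i, ι i (π i f) := by
    refine Lp.ext ?_
    have h1 : ∀ᵐ ω ∂μ, ∀ i, ι i (π i f) ω = Pi.single i (f ω i) := by
      refine ae_all_iff.2 fun i => ?_
      filter_upwards [hπ i f, (ContinuousLinearMap.single ℝ (fun _ : Fin d => ℝ) i).coeFn_compLpL
        (π i f)] with ω h1 h2
      rw [h2, h1]
      rfl
    filter_upwards [h1, Lp.coeFn_finsetSum Finset.univ fun i => ι i (π i f)] with ω h1 h2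
    rw [h2, Finset.sum_apply, Finset.sum_congr rfl fun i _ => h1 i]
    exact (Finset.univ_sum_single (f ω)).symm
  have h1 : φ f = ∑ i, ∫ ω, Z i ω * f ω i ∂μ := by
    conv_lhs => rw [hsum, map_sum]
    refine Finset.sum_congr rfl fun i _ => ?_
    rw [← ContinuousLinearMap.comp_apply, hZ]
    refine integral_congr_ae ?_
    filter_upwards [hπ i f] with ω h
    rw [h]
  rw [h1, ← integral_finsetSum]
  · rfl
  · intro i _
    exact ((L1.integrable_coeFn f).eval i).bdd_mul (c := C i) (hZm i).aestronglyMeasurable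
      (Eventually.of_forall (hC i))

end Duality

/-! ### Algebra of transfer maps. -/

section TransferMaps

variable {d : ℕ} {𝒜 : ProperCone ℝ (Mat d)}

theorem IsTransferMap.map_zero {f : Mat d → Vec d} (hf : IsTransferMap 𝒜 f) : f 0 = 0 := by
  simpa using hf.homogeneous 0 le_rfl 0

theorem IsTransferMap.add_le {f : Mat d → Vec d} (hf : IsTransferMap 𝒜 f) {a a' : Mat d}
    (ha : a ∈ 𝒜) (ha' : a' ∈ 𝒜) : f a + f a' ≤ f (a + a') := by
  simpa using hf.superadditive 1 1 zero_le_one zero_le_one a ha a' ha'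

theorem IsTransferMap.map_smul_of_neg {f : Mat d → Vec d} (hf : IsTransferMap 𝒜 f) {a : Mat d}
    (hfa : f (-a) = -f a) (c : ℝ) : f (c • a) = c • f a := by
  rcases le_total 0 c with h | h
  · exact hf.homogeneous c h a
  · have := hf.homogeneous (-c) (neg_nonneg.2 h) (-a)
    rwa [smul_neg, neg_smul, neg_neg, hfa, neg_smul, smul_neg, neg_neg] at this

theorem smul_mem_of_neg_mem {a : Mat d} (ha : a ∈ 𝒜) (ha' : -a ∈ 𝒜) (c : ℝ) : c • a ∈ 𝒜 := by
  rcases le_total 0 c with h | h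
  · exact 𝒜.smul_mem ha h
  · have := 𝒜.smul_mem ha' (neg_nonneg.2 h)
    rwa [smul_neg, neg_smul, neg_neg] at this

end TransferMaps

/-! ### Stability of the admissible positions. -/

section Strategies

variable {Ω : Type*} {mΩ : MeasurableSpace Ω} {μ : Measure Ω} {d : ℕ} {𝒜 : ProperCone ℝ (Mat d)}
  {m : MeasurableSpace Ω}

theorem zero_mem_L0 : (fun _ => 0) ∈ L0 μ (𝒜 : Set (Mat d)) m :=
  ⟨measurable_const, Eventually.of_forall fun _ => 𝒜.zero_mem⟩

theorem add_mem_L0 {η ζ : Ω → Mat d} (hη : η ∈ L0 μ (𝒜 : Set (Mat d)) m)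
    (hζ : ζ ∈ L0 μ (𝒜 : Set (Mat d)) m) :
    (fun ω => η ω + ζ ω) ∈ L0 μ (𝒜 : Set (Mat d)) m := by
  refine ⟨hη.1.add hζ.1, ?_⟩
  filter_upwards [hη.2, hζ.2] with ω h1 h2 using 𝒜.add_mem h1 h2

theorem smul_mem_L0 {c : Ω → ℝ} (hc : Measurable[m] c) (hc0 : ∀ ω, 0 ≤ c ω) {η : Ω → Mat d}
    (hη : η ∈ L0 μ (𝒜 : Set (Mat d)) m) :
    (fun ω => c ω • η ω) ∈ L0 μ (𝒜 : Set (Mat d)) m := by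
  refine ⟨hc.smul hη.1, ?_⟩
  filter_upwards [hη.2] with ω h1 using 𝒜.smul_mem h1 (hc0 ω)

theorem apply_nat_mem_L0 {η : ℕ → Ω → Mat d} (hη : ∀ n, η n ∈ L0 μ (𝒜 : Set (Mat d)) m)
    {τ : Ω → ℕ} (hτ : Measurable[m] τ) :
    (fun ω => η (τ ω) ω) ∈ L0 μ (𝒜 : Set (Mat d)) m := by
  refine ⟨measurable_apply_nat (fun n => (hη n).1) hτ, ?_⟩
  filter_upwards [ae_all_iff.2 fun n => (hη n).2] with ω h using h _

end Strategies

/-! ### The convex cone of superreplicable claims. -/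

section Attainable

variable {Ω : Type*} {mΩ : MeasurableSpace Ω} {d T : ℕ}

/-- The claims dominated by the terminal value of a strategy that trades from time `s` on. -/
def attainableFrom (μ : Measure Ω) (ℋ : Filtration (Fin (T + 1)) mΩ) (𝒜 : ProperCone ℝ (Mat d))
    (F : Fin (T + 1) → Ω → Mat d → Vec d) (s : ℕ) : Set (Ω → Vec d) :=
  {g | ∃ η : Fin (T + 1) → Ω → Mat d, (∀ t, η t ∈ L0 μ (𝒜 : Set (Mat d)) (ℋ t)) ∧
    ∀ᵐ ω ∂μ, g ω ≤ ∑ t with s ≤ t.val, F t ω (η t ω)}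

variable {μ : Measure Ω} {ℋ : Filtration (Fin (T + 1)) mΩ} {𝒜 : ProperCone ℝ (Mat d)}
  {F : Fin (T + 1) → Ω → Mat d → Vec d}

theorem IsTransferSequence.ae_forall (hF : IsTransferSequence μ 𝒜 F) :
    ∀ᵐ ω ∂μ, ∀ t, IsTransferMap 𝒜 (F t ω) :=
  ae_all_iff.2 hF.transferMap

theorem attainableFrom.mono {s : ℕ} {g g' : Ω → Vec d} (hg : g ∈ attainableFrom μ ℋ 𝒜 F s)
    (h : ∀ᵐ ω ∂μ, g' ω ≤ g ω) : g' ∈ attainableFrom μ ℋ 𝒜 F s := by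
  obtain ⟨η, hη, hle⟩ := hg
  refine ⟨η, hη, ?_⟩
  filter_upwards [hle, h] with ω h1 h2 using h2.trans h1

/-- Superadditivity makes the summed strategy yield at least the sum of the two values; this is why
claims are only required to be dominated. -/
theorem attainableFrom.add (hF : IsTransferSequence μ 𝒜 F) {s : ℕ} {g g' : Ω → Vec d}
    (hg : g ∈ attainableFrom μ ℋ 𝒜 F s) (hg' : g' ∈ attainableFrom μ ℋ 𝒜 F s) :
    (fun ω => g ω + g' ω) ∈ attainableFrom μ ℋ 𝒜 F s := by
  obtain ⟨η, hη, hle⟩ := hg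
  obtain ⟨ζ, hζ, hle'⟩ := hg'
  refine ⟨fun t ω => η t ω + ζ t ω, fun t => add_mem_L0 (hη t) (hζ t), ?_⟩
  filter_upwards [hle, hle', hF.ae_forall, ae_all_iff.2 fun t => (hη t).2,
    ae_all_iff.2 fun t => (hζ t).2] with ω h1 h2 h3 h4 h5
  refine (add_le_add h1 h2).trans ?_
  rw [← Finset.sum_add_distrib]
  exact Finset.sum_le_sum fun t _ => (h3 t).add_le (h4 t) (h5 t)

theorem zero_mem_attainableFrom (hF : IsTransferSequence μ 𝒜 F) (s : ℕ) :
    (fun _ => 0) ∈ attainableFrom μ ℋ 𝒜 F s := by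
  refine ⟨fun _ _ => 0, fun t => zero_mem_L0, ?_⟩
  filter_upwards [hF.ae_forall] with ω h
  simp [fun t => (h t).map_zero]

theorem attainableFrom.sum (hF : IsTransferSequence μ 𝒜 F) {s : ℕ} {ι : Type*} (S : Finset ι)
    {g : ι → Ω → Vec d} (hg : ∀ i ∈ S, g i ∈ attainableFrom μ ℋ 𝒜 F s) :
    (fun ω => ∑ i ∈ S, g i ω) ∈ attainableFrom μ ℋ 𝒜 F s := by
  classical
  induction S using Finset.induction_on with
  | empty => simpa using zero_mem_attainableFrom hF s
  | insert i S hi ih =>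
    simp only [Finset.sum_insert hi]
    exact attainableFrom.add hF (hg i (Finset.mem_insert_self i S))
      (ih fun j hj => hg j (Finset.mem_insert_of_mem hj))

theorem attainableFrom.smul (hF : IsTransferSequence μ 𝒜 F) {s : ℕ} {g : Ω → Vec d}
    (hg : g ∈ attainableFrom μ ℋ 𝒜 F s) {c : Ω → ℝ}
    (hc : ∀ t : Fin (T + 1), s ≤ t.val → Measurable[ℋ t] c) (hc0 : ∀ ω, 0 ≤ c ω) :
    (fun ω => c ω • g ω) ∈ attainableFrom μ ℋ 𝒜 F s := by
  obtain ⟨η, hη, hle⟩ := hg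
  refine ⟨fun t => if s ≤ t.val then fun ω => c ω • η t ω else fun _ => 0, fun t => ?_, ?_⟩
  · dsimp only
    split_ifs with h
    · exact smul_mem_L0 (hc t h) hc0 (hη t)
    · exact zero_mem_L0
  · filter_upwards [hle, hF.ae_forall] with ω h1 h2
    refine (smul_le_smul_of_nonneg_left h1 (hc0 ω)).trans (le_of_eq ?_)
    rw [Finset.smul_sum]
    refine Finset.sum_congr rfl fun t ht => ?_
    rw [if_pos (Finset.mem_filter.1 ht).2, (h2 t).homogeneous _ (hc0 ω)]

theorem sum_from_eq_add {M : Type*} [AddCommMonoid M] (t₀ : Fin (T + 1))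
    (f : Fin (T + 1) → M) :
    ∑ t with t₀.val ≤ t.val, f t = f t₀ + ∑ t with t₀.val + 1 ≤ t.val, f t := by
  classical
  rw [← Finset.sum_insert (s := Finset.univ.filter fun t : Fin (T + 1) => t₀.val + 1 ≤ t.val)
    (by simp)]
  refine Finset.sum_congr ?_ fun _ _ => rfl
  ext t
  simp only [Finset.mem_filter, Finset.mem_univ, true_and, Finset.mem_insert, Fin.ext_iff]
  omega

theorem attainableFrom.add_ev {t₀ : Fin (T + 1)} {g : Ω → Vec d}
    (hg : g ∈ attainableFrom μ ℋ 𝒜 F (t₀.val + 1)) {η : Ω → Mat d}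
    (hη : η ∈ L0 μ (𝒜 : Set (Mat d)) (ℋ t₀)) :
    (fun ω => F t₀ ω (η ω) + g ω) ∈ attainableFrom μ ℋ 𝒜 F t₀.val := by
  classical
  obtain ⟨ζ, hζ, hle⟩ := hg
  refine ⟨Function.update ζ t₀ η, fun t => ?_, ?_⟩
  · by_cases h : t = t₀
    · subst h; simpa using hη
    · simpa [h] using hζ t
  · filter_upwards [hle] with ω h
    rw [sum_from_eq_add, Function.update_self]
    refine add_le_add le_rfl (h.trans (le_of_eq ?_))
    refine Finset.sum_congr rfl fun t ht => ?_
    rw [Function.update_of_ne]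
    rintro rfl
    have := (Finset.mem_filter.1 ht).2
    omega

theorem measurable_sum_parts (hF : IsTransferSequence μ 𝒜 F) (t : Fin (T + 1)) {η : Ω → Mat d}
    (hη : Measurable η) : Measurable fun ω =>
      ∑ i, ∑ j, ((η ω i j)⁺ • F t ω (e i j) + (η ω i j)⁻ • F t ω (-e i j)) := by
  refine Finset.measurable_fun_sum _ fun i _ => Finset.measurable_fun_sum _ fun j _ => ?_
  have h : Measurable fun ω => η ω i j := (measurable_pi_apply j).comp
    ((measurable_pi_apply i).comp hη)
  exact ((h.sup measurable_const).smul (hF.measurable t _)).add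
    ((h.neg.sup measurable_const).smul (hF.measurable t _))

/-- HA identifies `F_t(η)` with a measurable sum only almost surely; completeness of `μ` transfers
measurability. -/
theorem measurable_ev [μ.IsComplete] (hF : IsTransferSequence μ 𝒜 F) (hA : HA μ 𝒜 F)
    (t : Fin (T + 1)) {η : Ω → Mat d} (hη : Measurable η) : Measurable (ev F t η) :=
  (measurable_sum_parts hF t hη).congr_ae (EventuallyEq.symm (hA.decomposition t η hη))

theorem ev_mem_N {t : Fin (T + 1)} {η : Ω → Mat d} (hη : η ∈ L0 μ (𝒜 : Set (Mat d)) (ℋ t)) :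
    ev F t η ∈ N μ ℋ 𝒜 F t :=
  ⟨η, hη, EventuallyEq.rfl⟩

theorem zero_mem_N (hF : IsTransferSequence μ 𝒜 F) (t : Fin (T + 1)) :
    (0 : Ω → Vec d) ∈ N μ ℋ 𝒜 F t := by
  refine ⟨fun _ => 0, zero_mem_L0, ?_⟩
  filter_upwards [hF.transferMap t] with ω h
  exact h.map_zero.symm

theorem V_last (ξ : Fin (T + 1) → Ω → Vec d) : V (Fin.last T) ξ = ∑ t, ξ t := by
  rw [V]
  congr 1
  ext t
  simp [Fin.le_last]

theorem KP.reversible_of_nonneg [μ.IsComplete] (hKP : KP μ ℋ 𝒜 F)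
    (hF : IsTransferSequence μ 𝒜 F) (hA : HA μ 𝒜 F) {ζ : Fin (T + 1) → Ω → Mat d}
    (hζ : ∀ t, ζ t ∈ L0 μ (𝒜 : Set (Mat d)) (ℋ t))
    (hpos : ∀ᵐ ω ∂μ, 0 ≤ ∑ t, F t ω (ζ t ω)) :
    (∀ t, ev F t (ζ t) ∈ N0 μ ℋ 𝒜 F t) ∧ ∀ᵐ ω ∂μ, ∑ t, F t ω (ζ t ω) = 0 := by
  have hV : V (Fin.last T) (fun t => ev F t (ζ t)) +
      V (Fin.last T) (0 : Fin (T + 1) → Ω → Vec d) = fun ω => ∑ t, F t ω (ζ t ω) := by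
    rw [V_last, V_last]
    funext ω
    simp [ev]
  obtain ⟨h1, h2⟩ := hKP (fun t => ev F t (ζ t)) 0 (fun t => ev_mem_N (hζ t))
    (fun t => zero_mem_N hF t) (by
      rw [hV]
      exact ⟨Finset.measurable_fun_sum _ fun t _ =>
        measurable_ev hF hA t ((hζ t).1.mono (ℋ.le t) le_rfl), hpos⟩)
  rw [hV] at h2
  exact ⟨h1, h2⟩

theorem eq_zero_of_mem_attainableFrom [μ.IsComplete] (hKP : KP μ ℋ 𝒜 F)
    (hF : IsTransferSequence μ 𝒜 F) (hA : HA μ 𝒜 F) {g : Ω → Vec d}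
    (hg : g ∈ attainableFrom μ ℋ 𝒜 F 0) (hpos : ∀ᵐ ω ∂μ, 0 ≤ g ω) : g =ᵐ[μ] 0 := by
  obtain ⟨η, hη, hle⟩ := hg
  simp only [zero_le, Finset.filter_true] at hle
  have h := (hKP.reversible_of_nonneg hF hA hη (by
    filter_upwards [hle, hpos] with ω h1 h2 using h2.trans h1)).2
  filter_upwards [h, hle, hpos] with ω h1 h2 h3
  exact le_antisymm (h2.trans h1.le) h3

end Attainable

/-! ### Closedness of the cone under almost sure convergence. -/

section Closedness

variable {Ω : Type*} {mΩ : MeasurableSpace Ω} {d T : ℕ} {μ : Measure Ω}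
  {ℋ : Filtration (Fin (T + 1)) mΩ} {𝒜 : ProperCone ℝ (Mat d)}
  {F : Fin (T + 1) → Ω → Mat d → Vec d}

theorem measurable_indicator_one {m : MeasurableSpace Ω} {B : Set Ω} (hB : MeasurableSet[m] B) :
    Measurable[m] (B.indicator (1 : Ω → ℝ)) :=
  measurable_const.indicator hB

theorem measurable_inv_one_add_norm {m : MeasurableSpace Ω} {b : Ω → Mat d} (hb : Measurable b) :
    Measurable fun ω => (1 + ‖b ω‖)⁻¹ :=
  (measurable_const.add hb.norm).inv

/-- A sequence of random matrices has, along a measurable random subsequence, a limiting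
direction `y` and a limiting inverse size `c`. -/
theorem exists_limit_direction {m : MeasurableSpace Ω} (b : ℕ → Ω → Mat d)
    (hb : ∀ n, Measurable (b n)) :
    ∃ (τ : ℕ → Ω → ℕ) (y : Ω → Mat d) (c : Ω → ℝ), (∀ k, Measurable (τ k)) ∧
      (∀ k ω, k ≤ τ k ω) ∧ Measurable y ∧ Measurable c ∧ (∀ ω, 0 ≤ c ω) ∧
      (∀ ω, Tendsto (fun k => (1 + ‖b (τ k ω) ω‖)⁻¹) atTop (𝓝 (c ω))) ∧
      (∀ ω, Tendsto (fun k => (1 + ‖b (τ k ω) ω‖)⁻¹ • b (τ k ω) ω) atTop (𝓝 (y ω))) ∧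
      ∀ ω, ‖y ω‖ = 1 - c ω := by
  have hr0 : ∀ n ω, 0 < (1 + ‖b n ω‖)⁻¹ := fun n ω => by positivity
  have hr1 : ∀ n ω, (1 + ‖b n ω‖)⁻¹ ≤ 1 := fun n ω =>
    inv_le_one_of_one_le₀ (by linarith [norm_nonneg (b n ω)])
  have hrn : ∀ n ω, ‖(1 + ‖b n ω‖)⁻¹ • b n ω‖ = 1 - (1 + ‖b n ω‖)⁻¹ := fun n ω => by
    have : (1 + ‖b n ω‖) ≠ 0 := by positivity
    rw [norm_smul, Real.norm_of_nonneg (hr0 n ω).le]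
    field_simp
    ring
  have hrm : ∀ n, Measurable fun ω => (1 + ‖b n ω‖)⁻¹ := fun n =>
    measurable_inv_one_add_norm (hb n)
  -- The index `none` carries the inverse size and `some p` the normalised entries, so that one
  -- extraction makes all of them converge.
  obtain ⟨τ, x, hτ, hτk, hx, hlim⟩ := exists_measurable_subseq
    (ι := Option (Fin d × Fin d))
    (fun n ω o => o.elim (1 + ‖b n ω‖)⁻¹ fun p => ((1 + ‖b n ω‖)⁻¹ • b n ω) p.1 p.2)
    (fun n o => by
      cases o with
      | none => exact hrm n
      | some p =>
        exact (measurable_pi_apply p.2).comp ((measurable_pi_apply p.1).comp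
          ((hrm n).smul (hb n))))
    (fun n ω o => by
      cases o with
      | none => simpa only [Option.elim, abs_of_pos (hr0 n ω)] using hr1 n ω
      | some p =>
        simp only [Option.elim]
        rw [← Real.norm_eq_abs]
        refine ((norm_le_pi_norm _ p.2).trans (norm_le_pi_norm _ p.1)).trans ?_
        rw [hrn]
        linarith [hr0 n ω])
  have hlimc : ∀ ω, Tendsto (fun k => (1 + ‖b (τ k ω) ω‖)⁻¹) atTop (𝓝 (x ω none)) :=
    fun ω => hlim ω none
  have hlimy : ∀ ω, Tendsto (fun k => (1 + ‖b (τ k ω) ω‖)⁻¹ • b (τ k ω) ω) atTop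
      (𝓝 fun i j => x ω (some (i, j))) := fun ω =>
    tendsto_pi_nhds.2 fun i => tendsto_pi_nhds.2 fun j => hlim ω (some (i, j))
  refine ⟨τ, fun ω i j => x ω (some (i, j)), fun ω => x ω none, hτ, hτk,
    measurable_pi_lambda _ fun i => measurable_pi_lambda _ fun j => hx _, hx none,
    fun ω => ge_of_tendsto' (hlimc ω) fun k => (hr0 _ _).le, hlimc, hlimy, fun ω => ?_⟩
  refine tendsto_nhds_unique (hlimy ω).norm ?_
  simp only [hrn]
  exact tendsto_const_nhds.sub (hlimc ω)

/-- Sequential closedness under almost sure convergence. -/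
def AeSeqClosed (μ : Measure Ω) (K : Set (Ω → Vec d)) : Prop :=
  ∀ (g : ℕ → Ω → Vec d) (g' : Ω → Vec d), (∀ n, g n ∈ K) →
    (∀ᵐ ω ∂μ, Tendsto (fun n => g n ω) atTop (𝓝 (g' ω))) → g' ∈ K

/-- Following the strategy numbered `τ ω` stays adapted from `s` on because `τ` is already known at
`t₀`. -/
theorem attainableFrom.apply_nat {t₀ : Fin (T + 1)} {s : ℕ} (hs : t₀.val ≤ s) {g : ℕ → Ω → Vec d}
    {η : ℕ → Fin (T + 1) → Ω → Mat d} (hη : ∀ n t, η n t ∈ L0 μ (𝒜 : Set (Mat d)) (ℋ t))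
    (hle : ∀ n, ∀ᵐ ω ∂μ, g n ω ≤ ∑ t with s ≤ t.val, F t ω (η n t ω))
    {τ : Ω → ℕ} (hτ : Measurable[ℋ t₀] τ) :
    (fun ω => g (τ ω) ω) ∈ attainableFrom μ ℋ 𝒜 F s := by
  refine ⟨fun t => if s ≤ t.val then fun ω => η (τ ω) t ω else fun _ => 0, fun t => ?_, ?_⟩
  · dsimp only
    split_ifs with h
    · exact apply_nat_mem_L0 (fun n => hη n t)
        (hτ.mono (ℋ.mono (Fin.le_def.2 (hs.trans h))) le_rfl)
    · exact zero_mem_L0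
  · filter_upwards [ae_all_iff.2 hle] with ω h
    refine (h (τ ω)).trans (le_of_eq (Finset.sum_congr rfl fun t ht => ?_))
    rw [if_pos (Finset.mem_filter.1 ht).2]

/-- Induction on the set `S` of entries that the positions at `t₀` may use. Bounded positions
converge and leave a limit of claims attainable after `t₀`; exploding ones are shifted along a
worthless round trip until an entry of `S` becomes zero. -/
theorem mem_attainableFrom_of_support [μ.IsComplete] (hF : IsTransferSequence μ 𝒜 F)
    (hA : HA μ 𝒜 F) (hKP : KP μ ℋ 𝒜 F) (hHN : HN0 μ ℋ 𝒜 F) (t₀ : Fin (T + 1))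
    (hcl : AeSeqClosed μ (attainableFrom μ ℋ 𝒜 F (t₀.val + 1))) (S : Finset (Fin d × Fin d))
    (g : ℕ → Ω → Vec d) (g' : Ω → Vec d) (η : ℕ → Fin (T + 1) → Ω → Mat d)
    (hη : ∀ n t, η n t ∈ L0 μ (𝒜 : Set (Mat d)) (ℋ t))
    (hle : ∀ n, ∀ᵐ ω ∂μ, g n ω ≤ ∑ t with t₀.val ≤ t.val, F t ω (η n t ω))
    (hsupp : ∀ n ω, ∀ p ∉ S, η n t₀ ω p.1 p.2 = 0)
    (hlim : ∀ᵐ ω ∂μ, Tendsto (fun n => g n ω) atTop (𝓝 (g' ω))) :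
    g' ∈ attainableFrom μ ℋ 𝒜 F t₀.val := by
  classical
  induction S using Finset.strongInduction generalizing g g' η with
  | H S ih =>
  obtain ⟨τ, y, c, hτ, hτk, hy, hc, hc0, hlimc, hlimy, hnorm⟩ :=
    exists_limit_direction (m := ℋ t₀) (fun n => η n t₀) fun n => (hη n t₀).1
  have hmono : ∀ {t : Fin (T + 1)}, t₀.val ≤ t.val → ℋ t₀ ≤ ℋ t := fun h =>
    ℋ.mono (Fin.le_def.2 h)
  set b : ℕ → Ω → Mat d := fun k ω => η (τ k ω) t₀ ω with hb
  have hbL : ∀ k, b k ∈ L0 μ (𝒜 : Set (Mat d)) (ℋ t₀) := fun k =>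
    apply_nat_mem_L0 (fun n => hη n t₀) (hτ k)
  have hτlim : ∀ ω, Tendsto (fun k => τ k ω) atTop atTop := fun ω =>
    tendsto_atTop_mono (hτk · ω) tendsto_id
  have hglim : ∀ᵐ ω ∂μ, Tendsto (fun k => g (τ k ω) ω) atTop (𝓝 (g' ω)) := by
    filter_upwards [hlim] with ω h using h.comp (hτlim ω)
  have hrest : ∀ k, (fun ω => g (τ k ω) ω - F t₀ ω (b k ω)) ∈
      attainableFrom μ ℋ 𝒜 F (t₀.val + 1) := fun k =>
    attainableFrom.apply_nat (g := fun n ω => g n ω - F t₀ ω (η n t₀ ω)) (Nat.le_succ _) hη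
      (fun n => by
        filter_upwards [hle n] with ω h
        rw [sum_from_eq_add] at h
        exact sub_le_iff_le_add'.2 h) (hτ k)
  have hyA : ∀ᵐ ω ∂μ, y ω ∈ 𝒜 := by
    filter_upwards [ae_all_iff.2 fun k => (hbL k).2] with ω h
    refine 𝒜.isClosed.mem_of_tendsto (hlimy ω) (Eventually.of_forall fun k => ?_)
    exact 𝒜.smul_mem (h k) (by positivity)
  have hsuppy : ∀ ω, ∀ p ∉ S, y ω p.1 p.2 = 0 := by
    intro ω p hp
    have h1 : Tendsto (fun k => ((1 + ‖b k ω‖)⁻¹ • b k ω) p.1 p.2) atTop (𝓝 (y ω p.1 p.2)) :=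
      tendsto_pi_nhds.1 (tendsto_pi_nhds.1 (hlimy ω) p.1) p.2
    refine tendsto_nhds_unique h1 ?_
    simp [hb, hsupp _ _ p hp]
  -- where the strategies stay bounded, they converge
  set B : Set Ω := {ω | c ω ≠ 0} with hBdef
  have hBm : MeasurableSet[ℋ t₀] B := (measurableSet_eq_fun hc measurable_const).compl
  have hB : (fun ω => B.indicator (1 : Ω → ℝ) ω • g' ω) ∈ attainableFrom μ ℋ 𝒜 F t₀.val := by
    set w : Ω → ℝ := B.indicator 1 with hw
    have hwm : Measurable[ℋ t₀] w := measurable_indicator_one hBm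
    have hw0 : ∀ ω, 0 ≤ w ω := fun ω => Set.indicator_nonneg (fun _ _ => zero_le_one) ω
    have hyL : (fun ω => (w ω * (c ω)⁻¹) • y ω) ∈ L0 μ (𝒜 : Set (Mat d)) (ℋ t₀) :=
      smul_mem_L0 (hwm.mul hc.inv) (fun ω => mul_nonneg (hw0 ω) (inv_nonneg.2 (hc0 ω))) ⟨hy, hyA⟩
    have h1 : (fun ω => w ω • (g' ω - F t₀ ω ((c ω)⁻¹ • y ω))) ∈
        attainableFrom μ ℋ 𝒜 F (t₀.val + 1) := by
      refine hcl (fun k ω => w ω • (g (τ k ω) ω - F t₀ ω (b k ω))) _ (fun k =>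
        attainableFrom.smul hF (hrest k)
          (fun t ht => hwm.mono (hmono (by omega)) le_rfl) hw0) ?_
      filter_upwards [hglim, hF.transferMap t₀] with ω h1 h2
      by_cases hω : ω ∈ B
      · refine Tendsto.const_smul (h1.sub ((h2.continuous.tendsto _).comp ?_)) _
        have h3 := ((hlimc ω).inv₀ hω).smul (hlimy ω)
        refine h3.congr fun k => ?_
        rw [smul_smul, inv_mul_cancel₀ (by positivity), one_smul]
      · simp [hw, hω]
    refine attainableFrom.mono (attainableFrom.add_ev h1 hyL) ?_
    filter_upwards [hF.transferMap t₀] with ω h2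
    by_cases hω : ω ∈ B
    · simp [hw, hω]
    · simp [hw, hω, h2.map_zero]
  -- where they explode, the limiting direction is reversible
  set B₀ : Set Ω := {ω | c ω = 0} with hB₀def
  have hB₀m : MeasurableSet[ℋ t₀] B₀ := measurableSet_eq_fun hc measurable_const
  set w₀ : Ω → ℝ := B₀.indicator 1 with hw₀
  have hw₀m : Measurable[ℋ t₀] w₀ := measurable_indicator_one hB₀m
  have hw₀0 : ∀ ω, 0 ≤ w₀ ω := fun ω => Set.indicator_nonneg (fun _ _ => zero_le_one) ω
  have hw₀r : ∀ k, Measurable[ℋ t₀] fun ω => w₀ ω * (1 + ‖b k ω‖)⁻¹ := fun k =>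
    hw₀m.mul (measurable_inv_one_add_norm (hbL k).1)
  -- After division by `1 + ‖b k‖` the claims disappear in the limit, as `c = 0` on `B₀`, and only
  -- minus the value of the limiting direction remains.
  have hdir : (fun ω => w₀ ω • (-F t₀ ω (y ω))) ∈ attainableFrom μ ℋ 𝒜 F (t₀.val + 1) := by
    refine hcl (fun k ω => (w₀ ω * (1 + ‖b k ω‖)⁻¹) • (g (τ k ω) ω - F t₀ ω (b k ω))) _ (fun k =>
      attainableFrom.smul hF (hrest k) (fun t ht => (hw₀r k).mono (hmono (by omega)) le_rfl)
        fun ω => mul_nonneg (hw₀0 ω) (by positivity)) ?_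
    filter_upwards [hglim, hF.transferMap t₀] with ω h1 h2
    by_cases hω : ω ∈ B₀
    · have h3 : Tendsto (fun k => (1 + ‖b k ω‖)⁻¹ • g (τ k ω) ω -
          F t₀ ω ((1 + ‖b k ω‖)⁻¹ • b k ω)) atTop (𝓝 (c ω • g' ω - F t₀ ω (y ω))) :=
        ((hlimc ω).smul h1).sub ((h2.continuous.tendsto _).comp (hlimy ω))
      have hcω : c ω = 0 := hω
      rw [hcω, zero_smul, zero_sub] at h3
      simp only [mul_smul]
      refine Tendsto.const_smul (h3.congr fun k => ?_) _
      rw [h2.homogeneous _ (by positivity), smul_sub]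
    · simp [hw₀, hω]
  obtain ⟨ζ', hζ', hζle⟩ := hdir
  -- The round trip: take the limiting direction at `t₀` and offset it by the later trades `ζ'`. Its
  -- total is nonnegative, so KP applies.
  set ζ : Fin (T + 1) → Ω → Mat d := fun t => if t = t₀ then fun ω => w₀ ω • y ω else
    if t₀.val + 1 ≤ t.val then ζ' t else fun _ => 0 with hζdef
  have hζ : ∀ t, ζ t ∈ L0 μ (𝒜 : Set (Mat d)) (ℋ t) := by
    intro t
    simp only [hζdef]
    split_ifs with h1 h2
    · subst h1; exact smul_mem_L0 hw₀m hw₀0 ⟨hy, hyA⟩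
    · exact hζ' t
    · exact zero_mem_L0
  have hζ0 : ζ t₀ = fun ω => w₀ ω • y ω := by simp [hζdef]
  have hζsum : ∀ᵐ ω ∂μ, ∑ t, F t ω (ζ t ω) = ∑ t with t₀.val ≤ t.val, F t ω (ζ t ω) := by
    filter_upwards [hF.ae_forall] with ω h
    refine (Finset.sum_subset (Finset.filter_subset _ _) fun t _ ht => ?_).symm
    have ht' : ¬ t₀.val ≤ t.val := fun h => ht (Finset.mem_filter.2 ⟨Finset.mem_univ _, h⟩)
    have : ζ t ω = 0 := by
      simp only [hζdef]
      rw [if_neg (by rintro rfl; exact ht' le_rfl), if_neg (by omega)]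
    rw [this, (h t).map_zero]
  obtain ⟨hrev, hζzero⟩ := hKP.reversible_of_nonneg hF hA hζ (by
    filter_upwards [hζsum, hζle, hF.transferMap t₀] with ω h1 h2 h3
    rw [h1, sum_from_eq_add, hζ0]
    rw [h3.homogeneous _ (hw₀0 ω)]
    have h4 : ∑ t with t₀.val + 1 ≤ t.val, F t ω (ζ t ω) =
        ∑ t with t₀.val + 1 ≤ t.val, F t ω (ζ' t ω) := by
      refine Finset.sum_congr rfl fun t ht => ?_
      have ht' := (Finset.mem_filter.1 ht).2
      simp only [hζdef]
      rw [if_neg (by rintro rfl; omega), if_pos ht']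
    rw [h4]
    rw [smul_neg, neg_le_iff_add_nonneg'] at h2
    exact h2)
  have hneg : ∀ t, (∀ᵐ ω ∂μ, F t ω (-ζ t ω) = -F t ω (ζ t ω)) ∧ ∀ᵐ ω ∂μ, -ζ t ω ∈ 𝒜 := by
    intro t
    obtain ⟨h1, h2⟩ := hHN t (ζ t) (hζ t) (hrev t)
    exact ⟨h1, h2.2⟩
  -- eliminate one coordinate
  set D : Fin d × Fin d → Set Ω := fun p => B₀ ∩ {ω | y ω p.1 p.2 ≠ 0} with hDdef
  have hym : ∀ p : Fin d × Fin d, Measurable[ℋ t₀] fun ω => y ω p.1 p.2 := fun p =>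
    (measurable_pi_apply p.2).comp ((measurable_pi_apply p.1).comp hy)
  have hDm : ∀ p, MeasurableSet[ℋ t₀] (D p) := fun p =>
    hB₀m.inter (measurableSet_eq_fun (hym p) measurable_const).compl
  have hwD : ∀ p, Measurable[ℋ t₀] ((D p).indicator (1 : Ω → ℝ)) := fun p =>
    measurable_indicator_one (hDm p)
  have hwD0 : ∀ p ω, 0 ≤ (D p).indicator (1 : Ω → ℝ) ω := fun p ω =>
    Set.indicator_nonneg (fun _ _ => zero_le_one) ω
  have hD : ∀ p ∈ S, (fun ω => (D p).indicator (1 : Ω → ℝ) ω • g' ω) ∈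
      attainableFrom μ ℋ 𝒜 F t₀.val := by
    intro p hp
    set w : Ω → ℝ := (D p).indicator 1 with hw
    -- The multiple of `ζ` whose subtraction cancels the entry `p` of the position at `t₀`.
    set β : ℕ → Ω → ℝ := fun k ω => b k ω p.1 p.2 / y ω p.1 p.2 with hβ
    have hβm : ∀ k, Measurable[ℋ t₀] (β k) := fun k =>
      ((measurable_pi_apply p.2).comp ((measurable_pi_apply p.1).comp (hbL k).1)).div (hym p)
    refine ih (S.erase p) (Finset.erase_ssubset hp)
      (fun k ω => w ω • g (τ k ω) ω) _
      (fun k t => if t₀.val ≤ t.val then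
        fun ω => w ω • (η (τ k ω) t ω + -(β k ω) • ζ t ω) else fun _ => 0) ?_ ?_ ?_ ?_
    · intro k t
      split_ifs with ht
      · refine smul_mem_L0 ((hwD p).mono (hmono ht) le_rfl) (hwD0 p) (add_mem_L0
          (apply_nat_mem_L0 (fun n => hη n t) ((hτ k).mono (hmono ht) le_rfl)) ⟨?_, ?_⟩)
        · exact ((hβm k).neg.mono (hmono ht) le_rfl).smul (hζ t).1
        · filter_upwards [(hζ t).2, (hneg t).2] with ω h1 h2 using smul_mem_of_neg_mem h1 h2 _
      · exact zero_mem_L0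
    · intro k
      filter_upwards [ae_all_iff.2 hle, hF.ae_forall, hζsum, hζzero,
        ae_all_iff.2 fun t => (hneg t).1, ae_all_iff.2 fun t => (hneg t).2,
        ae_all_iff.2 fun t => (hζ t).2, ae_all_iff.2 fun n => ae_all_iff.2 fun t => (hη n t).2]
        with ω h1 h2 h3 h4 h5 h6 h7 h8
      refine (smul_le_smul_of_nonneg_left (h1 (τ k ω)) (hwD0 p ω)).trans ?_
      -- By HN⁰ each `F t` is homogeneous along `ζ` for negative scalars too, so any multiple of the
      -- round trip has total value zero. Superadditivity then lets it be merged into the strategy.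
      have hz : ∑ t with t₀.val ≤ t.val, F t ω (η (τ k ω) t ω) =
          ∑ t with t₀.val ≤ t.val, (F t ω (η (τ k ω) t ω) + F t ω (-(β k ω) • ζ t ω)) := by
        rw [Finset.sum_add_distrib]
        have : ∑ t with t₀.val ≤ t.val, F t ω (-(β k ω) • ζ t ω) =
            -(β k ω) • ∑ t with t₀.val ≤ t.val, F t ω (ζ t ω) := by
          rw [Finset.smul_sum]
          exact Finset.sum_congr rfl fun t _ => (h2 t).map_smul_of_neg (h5 t) _
        rw [this, ← h3, h4, smul_zero, add_zero]
      rw [hz, Finset.smul_sum]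
      refine Finset.sum_le_sum fun t ht => ?_
      rw [if_pos (Finset.mem_filter.1 ht).2, (h2 t).homogeneous _ (hwD0 p ω)]
      exact smul_le_smul_of_nonneg_left ((h2 t).add_le (h8 _ t)
        (smul_mem_of_neg_mem (h7 t) (h6 t) _)) (hwD0 p ω)
    · intro k ω q hq
      rw [if_pos le_rfl, hζ0]
      by_cases hω : ω ∈ D p
      · have hwω : w₀ ω = 1 := by simp [hw₀, hω.1]
        simp only [Pi.smul_apply, Pi.add_apply, smul_eq_mul, hwω, one_mul]
        by_cases hqp : q = p
        · subst hqp
          have hne : y ω q.1 q.2 ≠ 0 := hω.2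
          simp only [hβ, hb]
          field_simp
          simp
        · have hqS : q ∉ S := fun h => hq (Finset.mem_erase.2 ⟨hqp, h⟩)
          rw [hsupp _ _ q hqS, hsuppy ω q hqS]
          simp
      · simp [hw, hω]
    · filter_upwards [hglim] with ω h using h.const_smul _
  -- glue the pieces
  set M : Ω → ℝ := fun ω => B.indicator (1 : Ω → ℝ) ω + ∑ p ∈ S, (D p).indicator (1 : Ω → ℝ) ω with hM
  have hMm : Measurable[ℋ t₀] M :=
    (measurable_indicator_one hBm).add (Finset.measurable_fun_sum _ fun p _ => hwD p)
  have hM1 : ∀ ω, 0 < M ω := by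
    intro ω
    have hs : 0 ≤ ∑ p ∈ S, (D p).indicator (1 : Ω → ℝ) ω :=
      Finset.sum_nonneg fun p _ => hwD0 p ω
    by_cases hω : ω ∈ B
    · simp only [hM, Set.indicator_of_mem hω, Pi.one_apply]
      linarith
    · have hcω : c ω = 0 := not_not.1 hω
      -- Where `c = 0` the direction has norm `1`, hence a nonzero entry, necessarily in `S`.
      have : ∃ p ∈ S, y ω p.1 p.2 ≠ 0 := by
        by_contra! hcon
        have hy0 : y ω = 0 := by
          funext i j
          by_cases hp : (i, j) ∈ S
          · exact hcon (i, j) hp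
          · exact hsuppy ω (i, j) hp
        have := hnorm ω
        rw [hy0, hcω] at this
        simp at this
      obtain ⟨p, hp, hyp⟩ := this
      simp only [hM, Set.indicator_of_notMem hω, zero_add]
      refine Finset.sum_pos' (fun p _ => hwD0 p ω) ⟨p, hp, ?_⟩
      rw [Set.indicator_of_mem (show ω ∈ D p from ⟨hcω, hyp⟩)]
      exact one_pos
  have hsum := attainableFrom.smul hF (attainableFrom.add hF hB (attainableFrom.sum hF S hD)) (c := fun ω => (M ω)⁻¹)
    (fun t ht => (hMm.mono (hmono ht) le_rfl).inv) fun ω => (inv_pos.2 (hM1 ω)).le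
  refine attainableFrom.mono hsum (Eventually.of_forall fun ω => le_of_eq ?_)
  rw [← Finset.sum_smul, ← add_smul, smul_smul]
  exact (by rw [inv_mul_cancel₀ (hM1 ω).ne', one_smul] : ((M ω)⁻¹ * M ω) • g' ω = g' ω).symm

/-- Backward induction on the first trading date; from `T + 1` on no date is left and the claims are
those that are a.s. at most `0`. -/
theorem aeSeqClosed_attainableFrom [μ.IsComplete] (hF : IsTransferSequence μ 𝒜 F)
    (hA : HA μ 𝒜 F) (hKP : KP μ ℋ 𝒜 F) (hHN : HN0 μ ℋ 𝒜 F) (s : ℕ) (hs : s ≤ T + 1) :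
    AeSeqClosed μ (attainableFrom μ ℋ 𝒜 F s) := by
  induction hs using Nat.decreasingInduction with
  | self =>
    have hempty : (Finset.univ.filter fun t : Fin (T + 1) => T + 1 ≤ t.val) = ∅ :=
      Finset.filter_eq_empty_iff.2 fun t _ => by have := t.isLt; omega
    intro g g' hg hlim
    refine ⟨fun _ _ => 0, fun t => zero_mem_L0, ?_⟩
    choose η _ hη using hg
    filter_upwards [hlim, ae_all_iff.2 hη] with ω h1 h2
    simp only [hempty, Finset.sum_empty] at h2 ⊢
    exact le_of_tendsto' h1 h2
  | of_succ k hk ih =>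
    intro g g' hg hlim
    choose η hη hle using hg
    exact mem_attainableFrom_of_support hF hA hKP hHN ⟨k, by omega⟩ ih Finset.univ g g' η hη hle
      (fun n ω p hp => absurd (Finset.mem_univ p) hp) hlim

end Closedness

/-! ### Hahn–Banach separation and domination in the polar. -/

section Polar

variable {Ω : Type*} {mΩ : MeasurableSpace Ω} {μ : Measure Ω} {d : ℕ}

theorem condExp_le_of_forall_setIntegral_le [IsFiniteMeasure μ] {m : MeasurableSpace Ω}
    (hm : m ≤ mΩ) {X Y : Ω → ℝ} (hX : Integrable X μ) (hY : Integrable Y μ)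
    (h : ∀ B, MeasurableSet[m] B → ∫ ω in B, X ω ∂μ ≤ ∫ ω in B, Y ω ∂μ) :
    μ[X | m] ≤ᵐ[μ] μ[Y | m] := by
  refine ae_le_of_ae_le_trim (hm := hm) ?_
  refine ae_le_of_forall_setIntegral_le (integrable_condExp.trim hm stronglyMeasurable_condExp)
    (integrable_condExp.trim hm stronglyMeasurable_condExp) fun B hB _ => ?_
  rw [← setIntegral_trim hm stronglyMeasurable_condExp hB,
    ← setIntegral_trim hm stronglyMeasurable_condExp hB, setIntegral_condExp hm hX hB,
    setIntegral_condExp hm hY hB]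
  exact h B hB

theorem integrable_dotProduct {Z g : Ω → Vec d} (hZ : MemLp Z ∞ μ) (hg : Integrable g μ) :
    Integrable (fun ω => Z ω ⬝ᵥ g ω) μ :=
  integrable_finsetSum _ fun i _ => (hg.eval i).smul_of_top_right (hZ.eval i)

theorem memLp_top_of_abs_le [IsFiniteMeasure μ] {Z : Ω → Vec d} (hZ : Measurable Z) {C : ℝ}
    (hC : ∀ ω i, |Z ω i| ≤ C) : MemLp Z ∞ μ :=
  memLp_top_of_bound hZ.aestronglyMeasurable (|C|) (Eventually.of_forall fun ω =>
    (pi_norm_le_iff_of_nonneg (abs_nonneg C)).2 fun i => (hC ω i).trans (le_abs_self C))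

/-- The measurable `Z` with values in the unit cube such that `E[Z · g] ≤ 0` for all integrable
`g ∈ K`. -/
def unitPolar (μ : Measure Ω) (K : Set (Ω → Vec d)) : Set (Ω → Vec d) :=
  {Z | Measurable Z ∧ (∀ ω i, |Z ω i| ≤ 1) ∧
    ∀ g ∈ K, Integrable g μ → ∫ ω, Z ω ⬝ᵥ g ω ∂μ ≤ 0}

theorem unitPolar.memLp [IsFiniteMeasure μ] {K : Set (Ω → Vec d)} {Z : Ω → Vec d}
    (hZ : Z ∈ unitPolar μ K) : MemLp Z ∞ μ :=
  memLp_top_of_abs_le hZ.1 hZ.2.1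

/-- Separation of an integrable function from a convex cone that is closed under almost sure
convergence, by a bounded random variable. -/
theorem exists_mem_unitPolar_of_notMem [IsFiniteMeasure μ] {K : Set (Ω → Vec d)}
    (hzero : (fun _ => 0) ∈ K) (hadd : ∀ g ∈ K, ∀ g' ∈ K, (fun ω => g ω + g' ω) ∈ K)
    (hsmul : ∀ g ∈ K, ∀ c : ℝ, 0 ≤ c → (fun ω => c • g ω) ∈ K)
    (hcongr : ∀ g ∈ K, ∀ g', g' =ᵐ[μ] g → g' ∈ K) (hcl : AeSeqClosed μ K)
    {f : Ω → Vec d} (hf : Integrable f μ) (hfK : f ∉ K) :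
    ∃ Z ∈ unitPolar μ K, 0 < ∫ ω, Z ω ⬝ᵥ f ω ∂μ := by
  let C : Set (Lp (Vec d) 1 μ) := {u | (u : Ω → Vec d) ∈ K}
  have hsmulC : ∀ u ∈ C, ∀ c : ℝ, 0 ≤ c → c • u ∈ C := fun u hu c hc =>
    hcongr _ (hsmul _ hu c hc) _ (Lp.coeFn_smul c u)
  have hconv : Convex ℝ C := by
    intro u hu v hv a b ha hb _
    exact hcongr _ (hadd _ (hsmulC u hu a ha) _ (hsmulC v hv b hb)) _ (Lp.coeFn_add _ _)
  have hclosed : IsClosed C := by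
    refine IsSeqClosed.isClosed fun u u' hu hlim => ?_
    obtain ⟨ns, -, hns⟩ := (tendstoInMeasure_of_tendsto_Lp hlim).exists_seq_tendsto_ae
    exact hcl (fun n => u (ns n)) u' (fun n => hu _) hns
  have hfC : hf.toL1 f ∉ C := fun h => hfK (hcongr _ h _ hf.coeFn_toL1.symm)
  obtain ⟨φ, r, hφ, hr⟩ := geometric_hahn_banach_closed_point hconv hclosed hfC
  have h0C : (0 : Lp (Vec d) 1 μ) ∈ C := hcongr _ hzero _ (Lp.coeFn_zero _ _ _)
  have hr0 : 0 < r := by simpa using hφ 0 h0C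
  have hφ0 : ∀ u ∈ C, φ u ≤ 0 := by
    intro u hu
    by_contra! hpos
    -- This scaling gives the functional exactly the value `r`, against the strict bound on the
    -- cone.
    have := hφ _ (hsmulC u hu (r / φ u) (by positivity))
    rw [map_smul, smul_eq_mul, div_mul_cancel₀ _ hpos.ne'] at this
    exact lt_irrefl _ this
  obtain ⟨Z, hZm, ⟨M, hM⟩, hZ⟩ := exists_bounded_repr φ
  have hφZ : ∀ g : Ω → Vec d, ∀ hg : Integrable g μ, φ (hg.toL1 g) = ∫ ω, Z ω ⬝ᵥ g ω ∂μ := by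
    intro g hg
    rw [hZ]
    refine integral_congr_ae ?_
    filter_upwards [hg.coeFn_toL1] with ω h
    rw [h]
  have hM0 : 0 < |M| + 1 := by positivity
  have hscale : ∀ g : Ω → Vec d, ∫ ω, ((|M| + 1)⁻¹ • Z ω) ⬝ᵥ g ω ∂μ =
      (|M| + 1)⁻¹ * ∫ ω, Z ω ⬝ᵥ g ω ∂μ := by
    intro g
    rw [← integral_const_mul]
    simp only [smul_dotProduct, smul_eq_mul]
  refine ⟨fun ω => (|M| + 1)⁻¹ • Z ω, ⟨hZm.const_smul (|M| + 1)⁻¹, fun ω i => ?_, fun g hg hgi => ?_⟩, ?_⟩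
  · dsimp only
    rw [Pi.smul_apply, smul_eq_mul, abs_mul, abs_of_pos (inv_pos.2 hM0), inv_mul_le_iff₀ hM0]
    linarith [hM ω i, le_abs_self M]
  · rw [hscale, ← hφZ g hgi]
    exact mul_nonpos_of_nonneg_of_nonpos (inv_pos.2 hM0).le
      (hφ0 _ (hcongr _ hg _ hgi.coeFn_toL1))
  · rw [hscale, ← hφZ f hf]
    exact mul_pos (inv_pos.2 hM0) (hr0.trans hr)

/-- `Z'` dominates `Z` if `E[Z' · g] ≤ c E[Z · g]` on `K` for some `c > 0`. -/
def Dominates (μ : Measure Ω) (K : Set (Ω → Vec d)) (Z' Z : Ω → Vec d) : Prop :=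
  ∃ c : ℝ, 0 < c ∧ ∀ g ∈ K, Integrable g μ →
    ∫ ω, Z' ω ⬝ᵥ g ω ∂μ ≤ c * ∫ ω, Z ω ⬝ᵥ g ω ∂μ

/-- Take `Z = ∑ 2⁻⁽ⁿ⁺¹⁾ f n`. All terms are nonpositive on `K`, so the total is at most each single
term, with constant `2⁻⁽ⁿ⁺¹⁾`. -/
theorem exists_dominates [IsFiniteMeasure μ] {K : Set (Ω → Vec d)} (f : ℕ → Ω → Vec d)
    (hf : ∀ n, f n ∈ unitPolar μ K) :
    ∃ Z ∈ unitPolar μ K, ∀ n, Dominates μ K Z (f n) := by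
  have hgeo : HasSum (fun n : ℕ => (1 / 2 : ℝ) ^ n * (1 / 2)) 1 := by
    simpa using hasSum_geometric_two.mul_right (1 / 2 : ℝ)
  have hle : ∀ ω i n, ‖(1 / 2 : ℝ) ^ n * (1 / 2) * f n ω i‖ ≤ (1 / 2 : ℝ) ^ n * (1 / 2) := by
    intro ω i n
    rw [norm_mul, Real.norm_of_nonneg (by positivity)]
    exact mul_le_of_le_one_right (by positivity) ((hf n).2.1 ω i)
  have hsum : ∀ ω i, Summable fun n => (1 / 2 : ℝ) ^ n * (1 / 2) * f n ω i := fun ω i =>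
    Summable.of_norm_bounded hgeo.summable (hle ω i)
  set Z : Ω → Vec d := fun ω i => ∑' n, (1 / 2 : ℝ) ^ n * (1 / 2) * f n ω i with hZ
  have hZm : Measurable Z := by
    refine measurable_pi_lambda _ fun i => ?_
    refine measurable_of_tendsto_metrizable
      (f := fun N ω => ∑ n ∈ Finset.range N, (1 / 2 : ℝ) ^ n * (1 / 2) * f n ω i) (fun N => ?_)
      (tendsto_pi_nhds.2 fun ω => (hsum ω i).hasSum.tendsto_sum_nat)
    exact Finset.measurable_fun_sum _ fun n _ =>
      ((measurable_pi_apply i).comp (hf n).1).const_mul _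
  have hZb : ∀ ω i, |Z ω i| ≤ 1 := fun ω i => tsum_of_norm_bounded hgeo (hle ω i)
  have hint : ∀ g, Integrable g μ → HasSum (fun n =>
      (1 / 2 : ℝ) ^ n * (1 / 2) * ∫ ω, f n ω ⬝ᵥ g ω ∂μ) (∫ ω, Z ω ⬝ᵥ g ω ∂μ) := by
    intro g hg
    have hnorm : Integrable (fun ω => ∑ i, ‖g ω i‖) μ :=
      integrable_finsetSum _ fun i _ => (hg.eval i).norm
    have hterm : ∀ n, Integrable (fun ω => (1 / 2 : ℝ) ^ n * (1 / 2) * (f n ω ⬝ᵥ g ω)) μ :=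
      fun n => (integrable_dotProduct (unitPolar.memLp (hf n)) hg).const_mul _
    have hbound : ∀ n, ∫ ω, ‖(1 / 2 : ℝ) ^ n * (1 / 2) * (f n ω ⬝ᵥ g ω)‖ ∂μ ≤
        (1 / 2 : ℝ) ^ n * (1 / 2) * ∫ ω, ∑ i, ‖g ω i‖ ∂μ := by
      intro n
      rw [← integral_const_mul]
      refine integral_mono (hterm n).norm (hnorm.const_mul _) fun ω => ?_
      simp only [norm_mul ((1 / 2 : ℝ) ^ n * (1 / 2))]
      rw [Real.norm_of_nonneg (by positivity)]
      refine mul_le_mul_of_nonneg_left ((norm_sum_le _ _).trans ?_) (by positivity)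
      refine Finset.sum_le_sum fun i _ => ?_
      rw [norm_mul]
      exact mul_le_of_le_one_left (norm_nonneg _) ((hf n).2.1 ω i)
    have key := hasSum_integral_of_summable_integral_norm hterm
      (Summable.of_nonneg_of_le (fun n => integral_nonneg fun ω => norm_nonneg _) hbound
        (hgeo.summable.mul_right _))
    have hlhs : ∀ n, ∫ ω, (1 / 2 : ℝ) ^ n * (1 / 2) * (f n ω ⬝ᵥ g ω) ∂μ =
        (1 / 2 : ℝ) ^ n * (1 / 2) * ∫ ω, f n ω ⬝ᵥ g ω ∂μ := fun n => integral_const_mul _ _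
    have hrhs : ∀ ω, ∑' n, (1 / 2 : ℝ) ^ n * (1 / 2) * (f n ω ⬝ᵥ g ω) = Z ω ⬝ᵥ g ω := by
      intro ω
      have h1 : HasSum (fun n => ∑ i, (1 / 2 : ℝ) ^ n * (1 / 2) * f n ω i * g ω i)
          (∑ i, Z ω i * g ω i) :=
        hasSum_sum fun i _ => (hsum ω i).hasSum.mul_right (g ω i)
      refine HasSum.tsum_eq (h1.congr_fun fun n => ?_)
      simp only [dotProduct, Finset.mul_sum, mul_assoc]
    simpa only [hlhs, hrhs] using key
  have hnonpos : ∀ g ∈ K, Integrable g μ → ∀ n,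
      (1 / 2 : ℝ) ^ n * (1 / 2) * ∫ ω, f n ω ⬝ᵥ g ω ∂μ ≤ 0 := fun g hg hgi n =>
    mul_nonpos_of_nonneg_of_nonpos (by positivity) ((hf n).2.2 g hg hgi)
  refine ⟨Z, ⟨hZm, hZb, fun g hg hgi => HasSum.nonpos (hnonpos g hg hgi) (hint g hgi)⟩,
    fun n => ⟨(1 / 2) ^ n * (1 / 2), by positivity, fun g hg hgi => ?_⟩⟩
  have := le_hasSum (hint g hgi).neg n fun k _ => neg_nonneg.2 (hnonpos g hg hgi k)
  linarith

end Polar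

/-! ### The conditional value as a random continuous function. -/

section DualValue

variable {Ω : Type*} {mΩ : MeasurableSpace Ω} {d T : ℕ}

/-- The conditional value `a ↦ E[Z · F_t(a) | ℋ_t]`, as a random function of the matrix `a`. -/
noncomputable def dualValue (μ : Measure Ω) (ℋ : Filtration (Fin (T + 1)) mΩ)
    (F : Fin (T + 1) → Ω → Mat d → Vec d) (t : Fin (T + 1)) (Z : Ω → Vec d) (ω : Ω)
    (a : Mat d) : ℝ :=
  ∑ i, ∑ j, ((a i j)⁺ * (μ[fun ω => Z ω ⬝ᵥ F t ω (e i j) | ℋ t]) ω +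
    (a i j)⁻ * (μ[fun ω => Z ω ⬝ᵥ F t ω (-e i j) | ℋ t]) ω)

variable {μ : Measure Ω} {ℋ : Filtration (Fin (T + 1)) mΩ} {𝒜 : ProperCone ℝ (Mat d)}
  {F : Fin (T + 1) → Ω → Mat d → Vec d} {t : Fin (T + 1)} {Z : Ω → Vec d}

theorem dualValue_smul (ω : Ω) {c : ℝ} (hc : 0 ≤ c) (a : Mat d) :
    dualValue μ ℋ F t Z ω (c • a) = c * dualValue μ ℋ F t Z ω a := by
  simp only [dualValue, Finset.mul_sum, mul_add, ← mul_assoc]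
  refine Finset.sum_congr rfl fun i _ => Finset.sum_congr rfl fun j _ => ?_
  have h1 : (c * a i j)⁺ = c * (a i j)⁺ := by
    simp only [posPart_def, mul_max_of_nonneg _ _ hc, mul_zero]
  have h2 : (c * a i j)⁻ = c * (a i j)⁻ := by
    simp only [negPart_def, mul_max_of_nonneg _ _ hc, mul_zero, mul_neg]
  simp only [Pi.smul_apply, smul_eq_mul, h1, h2]

theorem continuous_dualValue (ω : Ω) : Continuous (dualValue μ ℋ F t Z ω) := by
  unfold dualValue
  refine continuous_finsetSum _ fun i _ => continuous_finsetSum _ fun j _ => ?_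
  have h : Continuous fun a : Mat d => a i j := (continuous_apply j).comp (continuous_apply i)
  exact ((h.sup continuous_const).mul continuous_const).add
    ((h.neg.sup continuous_const).mul continuous_const)

theorem measurable_dualValue {η : Ω → Mat d} (hη : Measurable[ℋ t] η) :
    Measurable[ℋ t] fun ω => dualValue μ ℋ F t Z ω (η ω) := by
  unfold dualValue
  refine Finset.measurable_fun_sum _ fun i _ => Finset.measurable_fun_sum _ fun j _ => ?_
  have h : Measurable[ℋ t] fun ω => η ω i j :=
    (measurable_pi_apply j).comp ((measurable_pi_apply i).comp hη)
  have hc : ∀ X : Ω → ℝ, Measurable[ℋ t] (μ[X | ℋ t]) := fun X =>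
    stronglyMeasurable_condExp.measurable
  exact (((measurable_id.sup measurable_const).comp h).mul (hc _)).add
    (((measurable_neg.sup measurable_const).comp h).mul (hc _))

theorem abs_posPart_le (x : ℝ) : |x⁺| ≤ |x| := by
  rw [abs_of_nonneg (posPart_nonneg x)]
  exact sup_le (le_abs_self x) (abs_nonneg x)

theorem abs_negPart_le (x : ℝ) : |x⁻| ≤ |x| := by
  rw [abs_of_nonneg (negPart_nonneg x)]
  exact sup_le (neg_le_abs x) (abs_nonneg x)

section Bounded

variable {η : Ω → Mat d} {C : ℝ}

theorem abs_apply_le_norm (a : Mat d) (i j : Fin d) : |a i j| ≤ ‖a‖ :=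
  (norm_le_pi_norm (a i) j).trans (norm_le_pi_norm a i)

theorem integrable_ev (hA : HA μ 𝒜 F) (hint : IntegrableTransfers μ F)
    (hη : Measurable η) (hC : ∀ ω, ‖η ω‖ ≤ C) : Integrable (ev F t η) μ := by
  have hm : ∀ i j, Measurable fun ω => η ω i j := fun i j =>
    (measurable_pi_apply j).comp ((measurable_pi_apply i).comp hη)
  refine Integrable.congr ?_ (EventuallyEq.symm (hA.decomposition t η hη))
  refine integrable_finsetSum _ fun i _ => integrable_finsetSum _ fun j _ => ?_
  refine Integrable.add ?_ ?_
  · exact (hint t i j).1.bdd_smul C ((hm i j).sup measurable_const).aestronglyMeasurable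
      (Eventually.of_forall fun ω =>
        (abs_posPart_le _).trans ((abs_apply_le_norm _ i j).trans (hC ω)))
  · exact (hint t i j).2.bdd_smul C ((hm i j).neg.sup measurable_const).aestronglyMeasurable
      (Eventually.of_forall fun ω =>
        (abs_negPart_le _).trans ((abs_apply_le_norm _ i j).trans (hC ω)))

/-- HA writes `F_t(η)` as a finite sum of fixed integrable vectors with bounded `ℋ_t`-measurable
coefficients, which come out of the conditional expectation. -/
theorem condExp_dotProduct_ev [IsFiniteMeasure μ] (hA : HA μ 𝒜 F)
    (hint : IntegrableTransfers μ F) (hZ : MemLp Z ∞ μ) (hη : Measurable[ℋ t] η)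
    (hC : ∀ ω, ‖η ω‖ ≤ C) :
    μ[fun ω => Z ω ⬝ᵥ ev F t η ω | ℋ t] =ᵐ[μ] fun ω => dualValue μ ℋ F t Z ω (η ω) := by
  have hη' : Measurable η := hη.mono (ℋ.le t) le_rfl
  have hm : ∀ i j, Measurable[ℋ t] fun ω => η ω i j := fun i j =>
    (measurable_pi_apply j).comp ((measurable_pi_apply i).comp hη)
  have hpull : ∀ (u : Ω → ℝ) (X : Ω → Vec d), Measurable[ℋ t] u → (∀ ω, |u ω| ≤ C) →
      Integrable X μ → Integrable (fun ω => u ω * (Z ω ⬝ᵥ X ω)) μ ∧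
      μ[fun ω => u ω * (Z ω ⬝ᵥ X ω) | ℋ t] =ᵐ[μ]
        fun ω => u ω * (μ[fun ω => Z ω ⬝ᵥ X ω | ℋ t]) ω := by
    intro u X hu hub hX
    have h1 := integrable_dotProduct hZ hX
    have h2 : Integrable (fun ω => u ω * (Z ω ⬝ᵥ X ω)) μ :=
      h1.bdd_mul (c := C) (hu.mono (ℋ.le t) le_rfl).aestronglyMeasurable
        (Eventually.of_forall hub)
    exact ⟨h2, condExp_mul_of_stronglyMeasurable_left hu.stronglyMeasurable h2 h1⟩
  have hp : ∀ i j, Measurable[ℋ t] fun ω => (η ω i j)⁺ := fun i j =>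
    (measurable_id.sup measurable_const).comp (hm i j)
  have hn : ∀ i j, Measurable[ℋ t] fun ω => (η ω i j)⁻ := fun i j =>
    (measurable_neg.sup measurable_const).comp (hm i j)
  have hP := fun i j => hpull _ _ (hp i j)
    (fun ω => (abs_posPart_le _).trans ((abs_apply_le_norm _ i j).trans (hC ω))) (hint t i j).1
  have hN := fun i j => hpull _ _ (hn i j)
    (fun ω => (abs_negPart_le _).trans ((abs_apply_le_norm _ i j).trans (hC ω))) (hint t i j).2
  have hdec : (fun ω => Z ω ⬝ᵥ ev F t η ω) =ᵐ[μ] ∑ p : Fin d × Fin d,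
      ((fun ω => (η ω p.1 p.2)⁺ * (Z ω ⬝ᵥ F t ω (e p.1 p.2))) +
        fun ω => (η ω p.1 p.2)⁻ * (Z ω ⬝ᵥ F t ω (-e p.1 p.2))) := by
    filter_upwards [hA.decomposition t η hη'] with ω h
    rw [ev, h, Finset.sum_apply, Fintype.sum_prod_type]
    simp only [dotProduct_sum, dotProduct_add, dotProduct_smul, smul_eq_mul, Pi.add_apply]
  have hsum := condExp_finsetSum (μ := μ) (s := Finset.univ)
    (f := fun p : Fin d × Fin d => (fun ω => (η ω p.1 p.2)⁺ * (Z ω ⬝ᵥ F t ω (e p.1 p.2))) +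
        fun ω => (η ω p.1 p.2)⁻ * (Z ω ⬝ᵥ F t ω (-e p.1 p.2)))
    (fun p _ => (hP p.1 p.2).1.add (hN p.1 p.2).1) (ℋ t)
  have hterm : ∀ᵐ ω ∂μ, ∀ p : Fin d × Fin d,
      (μ[(fun ω => (η ω p.1 p.2)⁺ * (Z ω ⬝ᵥ F t ω (e p.1 p.2))) +
        fun ω => (η ω p.1 p.2)⁻ * (Z ω ⬝ᵥ F t ω (-e p.1 p.2)) | ℋ t]) ω =
      (η ω p.1 p.2)⁺ * (μ[fun ω => Z ω ⬝ᵥ F t ω (e p.1 p.2) | ℋ t]) ω +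
        (η ω p.1 p.2)⁻ * (μ[fun ω => Z ω ⬝ᵥ F t ω (-e p.1 p.2) | ℋ t]) ω := by
    refine ae_all_iff.2 fun p => ?_
    filter_upwards [condExp_add (hP p.1 p.2).1 (hN p.1 p.2).1 (ℋ t), (hP p.1 p.2).2,
      (hN p.1 p.2).2] with ω h1 h2 h3
    rw [h1, Pi.add_apply, h2, h3]
  refine (condExp_congr_ae hdec).trans (hsum.trans ?_)
  filter_upwards [hterm] with ω h
  rw [Finset.sum_apply, Finset.sum_congr rfl fun p _ => h p, Fintype.sum_prod_type]
  rfl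

theorem ev_smul (hF : IsTransferSequence μ 𝒜 F) {c : Ω → ℝ} (hc : ∀ ω, 0 ≤ c ω) (η : Ω → Mat d) :
    ev F t (fun ω => c ω • η ω) =ᵐ[μ] fun ω => c ω • ev F t η ω := by
  filter_upwards [hF.transferMap t] with ω h using h.homogeneous _ (hc ω) _

theorem norm_normalized_le (a : Mat d) : ‖(1 + ‖a‖)⁻¹ • a‖ ≤ 1 := by
  rw [norm_smul, Real.norm_of_nonneg (by positivity), inv_mul_le_iff₀ (by positivity)]
  linarith

theorem one_add_norm_smul_normalized (a : Mat d) : (1 + ‖a‖) • (1 + ‖a‖)⁻¹ • a = a := by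
  rw [smul_smul, mul_inv_cancel₀ (by positivity), one_smul]

theorem measurable_normalized {m : MeasurableSpace Ω} (hη : Measurable η) :
    Measurable fun ω => (1 + ‖η ω‖)⁻¹ • η ω :=
  (measurable_inv_one_add_norm hη).smul hη

theorem measurable_one_add_norm {m : MeasurableSpace Ω} (hη : Measurable η) :
    Measurable fun ω => 1 + ‖η ω‖ :=
  hη.norm.const_add 1

/-- Removes the boundedness of `η`: normalise to norm at most `1`, then pull the `ℋ_t`-measurable
factor `1 + ‖η‖` out of the generalized conditional expectation. -/
theorem Fbar_eq_dualValue [IsFiniteMeasure μ] (hF : IsTransferSequence μ 𝒜 F)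
    (hA : HA μ 𝒜 F) (hint : IntegrableTransfers μ F) (hZ : MemLp Z ∞ μ) (hη : Measurable[ℋ t] η) :
    Fbar μ ℋ F t η Z =ᵐ[μ] fun ω => dualValue μ ℋ F t Z ω (η ω) := by
  set η' : Ω → Mat d := fun ω => (1 + ‖η ω‖)⁻¹ • η ω with hη'
  have hη'm : Measurable[ℋ t] η' := measurable_normalized hη
  have hη'b : ∀ ω, ‖η' ω‖ ≤ 1 := fun ω => norm_normalized_le _
  have hX : Integrable (fun ω => Z ω ⬝ᵥ ev F t η' ω) μ :=
    integrable_dotProduct hZ (integrable_ev hA hint (hη'm.mono (ℋ.le t) le_rfl) hη'b)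
  have heq : (fun ω => Z ω ⬝ᵥ ev F t η ω) =ᵐ[μ]
      fun ω => (1 + ‖η ω‖) * (Z ω ⬝ᵥ ev F t η' ω) := by
    filter_upwards [ev_smul (t := t) hF (c := fun ω => 1 + ‖η ω‖) (fun ω => by positivity) η']
      with ω h
    rw [← smul_eq_mul, ← dotProduct_smul, ← h]
    simp only [ev, hη', one_add_norm_smul_normalized]
  have hcongr : genCondExp μ (ℋ t) (fun ω => Z ω ⬝ᵥ ev F t η ω) =ᵐ[μ]
      genCondExp μ (ℋ t) (fun ω => (1 + ‖η ω‖) * (Z ω ⬝ᵥ ev F t η' ω)) := by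
    have h1 : (fun ω => ENNReal.ofReal (Z ω ⬝ᵥ ev F t η ω)) =ᵐ[μ]
        fun ω => ENNReal.ofReal ((1 + ‖η ω‖) * (Z ω ⬝ᵥ ev F t η' ω)) := by
      filter_upwards [heq] with ω h
      rw [h]
    have h2 : (fun ω => ENNReal.ofReal (-(Z ω ⬝ᵥ ev F t η ω))) =ᵐ[μ]
        fun ω => ENNReal.ofReal (-((1 + ‖η ω‖) * (Z ω ⬝ᵥ ev F t η' ω))) := by
      filter_upwards [heq] with ω h
      rw [h]
    filter_upwards [condLExp_congr_ae (mΩ := ℋ t) h1, condLExp_congr_ae (mΩ := ℋ t) h2]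
      with ω h1 h2
    simp only [genCondExp, h1, h2]
  refine hcongr.trans ((genCondExp_mul_left (ℋ.le t) (measurable_one_add_norm hη)
    (fun ω => by positivity) hX.1.aemeasurable).trans ?_)
  filter_upwards [genCondExp_of_integrable (m := ℋ t) hX,
    condExp_dotProduct_ev hA hint hZ hη'm hη'b] with ω h1 h2
  rw [h1, h2, ← dualValue_smul _ (by positivity)]
  simp only [hη', one_add_norm_smul_normalized]

end Bounded

end DualValue

/-! ### The maximal dual element and the two implications. -/

section Market

variable {Ω : Type*} {mΩ : MeasurableSpace Ω} {d T : ℕ} {μ : Measure Ω}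
  {ℋ : Filtration (Fin (T + 1)) mΩ} {𝒜 : ProperCone ℝ (Mat d)}
  {F : Fin (T + 1) → Ω → Mat d → Vec d} {t : Fin (T + 1)}

theorem sum_ev_update_zero (hF : IsTransferSequence μ 𝒜 F) (t : Fin (T + 1)) (η : Ω → Mat d) :
    ∀ᵐ ω ∂μ, ∑ s, F s ω (Function.update (fun _ _ => 0) t η s ω) = ev F t η ω := by
  filter_upwards [hF.ae_forall] with ω h
  rw [Finset.sum_eq_single t]
  · rw [Function.update_self, ev]
  · intro s _ hs
    rw [Function.update_of_ne hs]
    exact (h s).map_zero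
  · simp

theorem update_zero_mem_L0 {η : Ω → Mat d} (hη : η ∈ L0 μ (𝒜 : Set (Mat d)) (ℋ t))
    (s : Fin (T + 1)) :
    Function.update (fun _ _ => 0) t η s ∈ L0 μ (𝒜 : Set (Mat d)) (ℋ s) := by
  by_cases h : s = t
  · subst h; simpa using hη
  · rw [Function.update_of_ne h]
    exact zero_mem_L0

theorem ev_mem_attainableFrom (hF : IsTransferSequence μ 𝒜 F) {η : Ω → Mat d}
    (hη : η ∈ L0 μ (𝒜 : Set (Mat d)) (ℋ t)) : ev F t η ∈ attainableFrom μ ℋ 𝒜 F 0 := by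
  refine ⟨Function.update (fun _ _ => 0) t η, update_zero_mem_L0 hη, ?_⟩
  filter_upwards [sum_ev_update_zero hF t η] with ω h
  simp only [zero_le, Finset.filter_true]
  exact h.ge

/-- Restricting `η` to an event of `ℋ t` again gives an admissible position, so the inequality
between integrals localises to conditional expectations. -/
theorem dualValue_le_of_forall_integral_le [IsFiniteMeasure μ] (hF : IsTransferSequence μ 𝒜 F)
    (hA : HA μ 𝒜 F) (hint : IntegrableTransfers μ F) {Z Z' : Ω → Vec d} (hZ : MemLp Z ∞ μ)
    (hZ' : MemLp Z' ∞ μ) {c : ℝ} (h : ∀ g ∈ attainableFrom μ ℋ 𝒜 F 0, Integrable g μ →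
      ∫ ω, Z' ω ⬝ᵥ g ω ∂μ ≤ c * ∫ ω, Z ω ⬝ᵥ g ω ∂μ)
    {η : Ω → Mat d} (hη : η ∈ L0 μ (𝒜 : Set (Mat d)) (ℋ t)) {C : ℝ} (hC : ∀ ω, ‖η ω‖ ≤ C) :
    ∀ᵐ ω ∂μ, dualValue μ ℋ F t Z' ω (η ω) ≤ c * dualValue μ ℋ F t Z ω (η ω) := by
  have hev : Integrable (ev F t η) μ := integrable_ev hA hint (hη.1.mono (ℋ.le t) le_rfl) hC
  have hX := integrable_dotProduct hZ hev
  have hX' := integrable_dotProduct hZ' hev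
  have hle : μ[fun ω => Z' ω ⬝ᵥ ev F t η ω | ℋ t] ≤ᵐ[μ]
      μ[fun ω => c * (Z ω ⬝ᵥ ev F t η ω) | ℋ t] := by
    refine condExp_le_of_forall_setIntegral_le (ℋ.le t) hX' (hX.const_mul c) fun B hB => ?_
    have hB' : MeasurableSet B := ℋ.le t _ hB
    have hBη : (fun ω => B.indicator (1 : Ω → ℝ) ω • η ω) ∈ L0 μ (𝒜 : Set (Mat d)) (ℋ t) :=
      smul_mem_L0 (measurable_indicator_one hB)
        (fun ω => Set.indicator_nonneg (fun _ _ => zero_le_one) ω) hη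
    have hev' : ev F t (fun ω => B.indicator (1 : Ω → ℝ) ω • η ω) =ᵐ[μ]
        B.indicator (ev F t η) := by
      filter_upwards [ev_smul (t := t) hF (c := B.indicator (1 : Ω → ℝ))
        (fun ω => Set.indicator_nonneg (fun _ _ => zero_le_one) ω) η] with ω h
      rw [h]
      by_cases hω : ω ∈ B <;> simp [hω]
    have key := h _ (ev_mem_attainableFrom hF hBη) ((hev.indicator hB').congr hev'.symm)
    have hind : ∀ W : Ω → Vec d,
        ∫ ω, W ω ⬝ᵥ ev F t (fun ω => B.indicator (1 : Ω → ℝ) ω • η ω) ω ∂μ =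
          ∫ ω in B, W ω ⬝ᵥ ev F t η ω ∂μ := by
      intro W
      rw [← integral_indicator hB']
      refine integral_congr_ae ?_
      filter_upwards [hev'] with ω h
      rw [h]
      by_cases hω : ω ∈ B <;> simp [hω]
    rw [hind, hind] at key
    rwa [integral_const_mul]
  filter_upwards [hle, condExp_dotProduct_ev hA hint hZ hη.1 hC,
    condExp_dotProduct_ev hA hint hZ' hη.1 hC,
    condExp_smul (μ := μ) c (fun ω => Z ω ⬝ᵥ ev F t η ω) (ℋ t)] with ω h1 h2 h3 h4
  rw [← h2, ← h3]
  exact h1.trans (le_of_eq h4)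

/-- Test with minus the `i`-th unit vector on an event: this claim lies below `0`, so it is
attainable. -/
theorem apply_le_of_forall_integral_le [IsFiniteMeasure μ] (hF : IsTransferSequence μ 𝒜 F)
    {Z Z' : Ω → Vec d} (hZ : MemLp Z ∞ μ)
    (hZ' : MemLp Z' ∞ μ) {c : ℝ} (h : ∀ g ∈ attainableFrom μ ℋ 𝒜 F 0, Integrable g μ →
      ∫ ω, Z' ω ⬝ᵥ g ω ∂μ ≤ c * ∫ ω, Z ω ⬝ᵥ g ω ∂μ) (i : Fin d) :
    ∀ᵐ ω ∂μ, c * Z ω i ≤ Z' ω i := by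
  refine ae_le_of_forall_setIntegral_le ((hZ.eval i).integrable le_top |>.const_mul c)
    ((hZ'.eval i).integrable le_top) fun B hB _ => ?_
  have hint : Integrable (B.indicator fun _ => (Pi.single i (-1) : Vec d)) μ :=
    (integrable_const _).indicator hB
  have key := h _ (attainableFrom.mono (zero_mem_attainableFrom hF 0) (Eventually.of_forall fun ω =>
    Set.indicator_le' (s := B) (f := fun _ => (Pi.single i (-1) : Vec d)) (g := fun _ => 0)
      (fun _ _ => by simp) (fun _ _ => le_rfl) ω)) hint
  have hind : ∀ W : Ω → Vec d,
      ∫ ω, W ω ⬝ᵥ B.indicator (fun _ => (Pi.single i (-1) : Vec d)) ω ∂μ =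
        -∫ ω in B, W ω i ∂μ := by
    intro W
    rw [← integral_neg, ← integral_indicator hB]
    congr 1
    funext ω
    by_cases hω : ω ∈ B <;> simp [hω]
  rw [hind, hind] at key
  rw [integral_const_mul]
  linarith

theorem nonpos_of_mem_unitPolar [IsFiniteMeasure μ] (hF : IsTransferSequence μ 𝒜 F)
    (hA : HA μ 𝒜 F) (hint : IntegrableTransfers μ F) {Z : Ω → Vec d}
    (hZ : Z ∈ unitPolar μ (attainableFrom μ ℋ 𝒜 F 0)) {η : Ω → Mat d}
    (hη : η ∈ L0 μ (𝒜 : Set (Mat d)) (ℋ t)) :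
    ∀ᵐ ω ∂μ, dualValue μ ℋ F t Z ω (η ω) ≤ 0 := by
  have h := dualValue_le_of_forall_integral_le (t := t) hF hA hint (unitPolar.memLp hZ)
    (unitPolar.memLp hZ) (c := 0) (fun g hg hgi => by rw [zero_mul]; exact hZ.2.2 g hg hgi)
    (smul_mem_L0 (measurable_inv_one_add_norm hη.1) (fun ω => by positivity) hη)
    (fun ω => norm_normalized_le (η ω))
  filter_upwards [h] with ω h
  rw [zero_mul, dualValue_smul _ (by positivity)] at h
  exact nonpos_of_mul_nonpos_right h (by positivity)

/-- The event that the conditional value is bounded away from `0` on the part of the cone `𝒜` in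
the `k`-th ball around the `q`-th point of a dense sequence. -/
def negativeOnBall (μ : Measure Ω) (ℋ : Filtration (Fin (T + 1)) mΩ) (𝒜 : ProperCone ℝ (Mat d))
    (F : Fin (T + 1) → Ω → Mat d → Vec d) (t : Fin (T + 1)) (q k : ℕ) (Z : Ω → Vec d) : Set Ω :=
  {ω | ∃ l : ℕ, ∀ j, (TopologicalSpace.denseSeq 𝒜 j : Mat d) ∈
      Metric.ball (TopologicalSpace.denseSeq (Mat d) q) (1 / ((k : ℝ) + 1)) →
    dualValue μ ℋ F t Z ω (TopologicalSpace.denseSeq 𝒜 j) ≤ -(1 / ((l : ℝ) + 1))}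

theorem measurableSet_negativeOnBall (q k : ℕ) (Z : Ω → Vec d) :
    MeasurableSet (negativeOnBall μ ℋ 𝒜 F t q k Z) := by
  have : negativeOnBall μ ℋ 𝒜 F t q k Z = ⋃ l : ℕ, ⋂ j, ⋂ (_ : (TopologicalSpace.denseSeq 𝒜 j :
      Mat d) ∈ Metric.ball (TopologicalSpace.denseSeq (Mat d) q) (1 / ((k : ℝ) + 1))),
      {ω | dualValue μ ℋ F t Z ω (TopologicalSpace.denseSeq 𝒜 j) ≤ -(1 / ((l : ℝ) + 1))} := by
    ext ω
    simp [negativeOnBall]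
  rw [this]
  refine MeasurableSet.iUnion fun l => MeasurableSet.iInter fun j => MeasurableSet.iInter fun _ => ?_
  exact measurableSet_le ((measurable_dualValue (η := fun _ => _)
    measurable_const).mono (ℋ.le t) le_rfl) measurable_const

/-- Strict negativity at dense points would be lost in the limit; the uniform gap `1 / (l + 1)`
survives by continuity. -/
theorem dualValue_neg_of_mem_negativeOnBall {q k : ℕ} {Z : Ω → Vec d} {ω : Ω}
    (hω : ω ∈ negativeOnBall μ ℋ 𝒜 F t q k Z) {a : Mat d} (ha : a ∈ 𝒜)
    (hab : a ∈ Metric.ball (TopologicalSpace.denseSeq (Mat d) q) (1 / ((k : ℝ) + 1))) :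
    dualValue μ ℋ F t Z ω a < 0 := by
  obtain ⟨l, hl⟩ := hω
  have hl0 : (0 : ℝ) < 1 / ((l : ℝ) + 1) := by positivity
  by_contra! hcon
  have hopen : IsOpen {x : 𝒜 | (x : Mat d) ∈ Metric.ball (TopologicalSpace.denseSeq (Mat d) q)
      (1 / ((k : ℝ) + 1)) ∧ -(1 / ((l : ℝ) + 1)) < dualValue μ ℋ F t Z ω x} :=
    (Metric.isOpen_ball.preimage continuous_subtype_val).inter
      (isOpen_lt continuous_const ((continuous_dualValue ω).comp continuous_subtype_val))
  obtain ⟨x, hx, j, rfl⟩ := (TopologicalSpace.denseRange_denseSeq 𝒜).inter_open_nonempty _ hopen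
    ⟨⟨a, ha⟩, hab, by dsimp only; linarith⟩
  exact absurd (hl j hx.1) (not_le.2 hx.2)

theorem exists_mem_negativeOnBall {Z : Ω → Vec d} {ω : Ω} {a : Mat d}
    (ha : dualValue μ ℋ F t Z ω a < 0) :
    ∃ q k : ℕ, a ∈ Metric.ball (TopologicalSpace.denseSeq (Mat d) q) (1 / ((k : ℝ) + 1)) ∧
      ω ∈ negativeOnBall μ ℋ 𝒜 F t q k Z := by
  obtain ⟨l, hl⟩ := exists_nat_one_div_lt (neg_pos.2 ha)
  have hopen : IsOpen {x : Mat d | dualValue μ ℋ F t Z ω x < -(1 / ((l : ℝ) + 1))} :=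
    isOpen_lt (continuous_dualValue ω) continuous_const
  obtain ⟨ε, hε, hball⟩ := Metric.isOpen_iff.1 hopen a
    (show dualValue μ ℋ F t Z ω a < -(1 / ((l : ℝ) + 1)) by linarith)
  obtain ⟨k, hk⟩ := exists_nat_one_div_lt (half_pos hε)
  obtain ⟨q, hq⟩ := (TopologicalSpace.denseRange_denseSeq (Mat d)).exists_dist_lt a
    (show (0 : ℝ) < 1 / ((k : ℝ) + 1) by positivity)
  refine ⟨q, k, hq, l, fun j hj => le_of_lt (hball ?_)⟩
  rw [Metric.mem_ball] at hj ⊢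
  calc dist (TopologicalSpace.denseSeq 𝒜 j : Mat d) a
      ≤ dist (TopologicalSpace.denseSeq 𝒜 j : Mat d) (TopologicalSpace.denseSeq (Mat d) q) +
        dist (TopologicalSpace.denseSeq (Mat d) q) a := dist_triangle _ _ _
    _ < 1 / ((k : ℝ) + 1) + 1 / ((k : ℝ) + 1) := add_lt_add hj (by rwa [dist_comm])
    _ < ε := by linarith

/-- Domination with constant `c` multiplies the gap by `c`, and only the existence of some gap
matters. -/
theorem negativeOnBall_ae_le_of_dominates [IsFiniteMeasure μ] (hF : IsTransferSequence μ 𝒜 F)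
    (hA : HA μ 𝒜 F) (hint : IntegrableTransfers μ F) {Z Z' : Ω → Vec d} (hZ : MemLp Z ∞ μ)
    (hZ' : MemLp Z' ∞ μ) (h : Dominates μ (attainableFrom μ ℋ 𝒜 F 0) Z' Z) (q k : ℕ) :
    negativeOnBall μ ℋ 𝒜 F t q k Z ≤ᵐ[μ] negativeOnBall μ ℋ 𝒜 F t q k Z' := by
  obtain ⟨c, hc, h⟩ := h
  have hle : ∀ᵐ ω ∂μ, ∀ j, dualValue μ ℋ F t Z' ω (TopologicalSpace.denseSeq 𝒜 j) ≤
      c * dualValue μ ℋ F t Z ω (TopologicalSpace.denseSeq 𝒜 j) := by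
    refine ae_all_iff.2 fun j => ?_
    exact dualValue_le_of_forall_integral_le (t := t) hF hA hint hZ hZ' h
      (η := fun _ => TopologicalSpace.denseSeq 𝒜 j)
      ⟨measurable_const, Eventually.of_forall fun _ => (TopologicalSpace.denseSeq 𝒜 j).2⟩
      (C := ‖(TopologicalSpace.denseSeq 𝒜 j : Mat d)‖) fun _ => le_rfl
  filter_upwards [hle] with ω hω
  rintro ⟨l, hl⟩
  obtain ⟨l', hl'⟩ := exists_nat_one_div_lt (show 0 < c * (1 / ((l : ℝ) + 1)) by positivity)
  refine ⟨l', fun j hj => (hω j).trans ?_⟩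
  have := mul_le_mul_of_nonneg_left (hl j hj) hc.le
  linarith

/-- A maximal element of the polar: its support and its strict negativity region are the largest
possible. -/
theorem exists_maximal_mem_unitPolar [IsFiniteMeasure μ] (hF : IsTransferSequence μ 𝒜 F)
    (hA : HA μ 𝒜 F) (hint : IntegrableTransfers μ F) :
    ∃ Z' ∈ unitPolar μ (attainableFrom μ ℋ 𝒜 F 0), ∀ Z ∈ unitPolar μ (attainableFrom μ ℋ 𝒜 F 0),
      (∀ i, ∀ᵐ ω ∂μ, 0 < Z ω i → 0 < Z' ω i) ∧
      ∀ t q k, negativeOnBall μ ℋ 𝒜 F t q k Z ≤ᵐ[μ] negativeOnBall μ ℋ 𝒜 F t q k Z' := by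
  set P := unitPolar μ (attainableFrom μ ℋ 𝒜 F 0) with hP
  have hne : Nonempty P := ⟨⟨fun _ => 0, measurable_const, by simp, by simp⟩⟩
  let B : Fin d ⊕ (Fin (T + 1) × ℕ × ℕ) → P → Set Ω := fun q Z =>
    q.elim (fun i => {ω | 0 < Z.1 ω i}) fun p => negativeOnBall μ ℋ 𝒜 F p.1 p.2.1 p.2.2 Z.1
  obtain ⟨Z', hZ'⟩ := exists_forall_ae_le_of_dominated (μ := μ) B (fun q Z => by
    rcases q with i | p
    · exact measurableSet_lt measurable_const ((measurable_pi_apply i).comp Z.2.1)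
    · exact measurableSet_negativeOnBall _ _ _) (fun f => by
    obtain ⟨Z, hZ, hdom⟩ := exists_dominates (fun n => (f n).1) fun n => (f n).2
    refine ⟨⟨Z, hZ⟩, fun n q => ?_⟩
    rcases q with i | p
    · obtain ⟨c, hc, h⟩ := hdom n
      filter_upwards [apply_le_of_forall_integral_le hF (unitPolar.memLp (f n).2)
        (unitPolar.memLp hZ) h i] with ω hω
      intro hpos
      exact (mul_pos hc hpos).trans_le hω
    · exact negativeOnBall_ae_le_of_dominates hF hA hint (unitPolar.memLp (f n).2)
        (unitPolar.memLp hZ) (hdom n) _ _)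
  exact ⟨Z'.1, Z'.2, fun Z hZ => ⟨fun i => hZ' (Sum.inl i) ⟨Z, hZ⟩,
    fun t q k => hZ' (Sum.inr (t, q, k)) ⟨Z, hZ⟩⟩⟩

theorem exists_mem_unitPolar_attainableFrom [IsFiniteMeasure μ] [μ.IsComplete]
    (hF : IsTransferSequence μ 𝒜 F) (hA : HA μ 𝒜 F) (hKP : KP μ ℋ 𝒜 F) (hHN : HN0 μ ℋ 𝒜 F)
    {f : Ω → Vec d} (hf : Integrable f μ) (hfK : f ∉ attainableFrom μ ℋ 𝒜 F 0) :
    ∃ Z ∈ unitPolar μ (attainableFrom μ ℋ 𝒜 F 0), 0 < ∫ ω, Z ω ⬝ᵥ f ω ∂μ :=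
  exists_mem_unitPolar_of_notMem (zero_mem_attainableFrom hF 0)
    (fun _ hg _ hg' => attainableFrom.add hF hg hg')
    (fun _ hg _ hc => attainableFrom.smul hF hg (fun _ _ => measurable_const) fun _ => hc)
    (fun _ hg _ h => attainableFrom.mono hg h.le)
    (aeSeqClosed_attainableFrom hF hA hKP hHN 0 (Nat.zero_le _)) hf hfK

/-- Trading `η` at `t` alone and adding a strategy that superreplicates `-F_t(η)` gives a
nonnegative total, so KP makes the first strategy reversible. -/
theorem ev_mem_N0_of_neg_mem_attainableFrom [μ.IsComplete] (hF : IsTransferSequence μ 𝒜 F)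
    (hA : HA μ 𝒜 F) (hKP : KP μ ℋ 𝒜 F) {η : Ω → Mat d} (hη : η ∈ L0 μ (𝒜 : Set (Mat d)) (ℋ t))
    (h : (fun ω => -ev F t η ω) ∈ attainableFrom μ ℋ 𝒜 F 0) : ev F t η ∈ N0 μ ℋ 𝒜 F t := by
  obtain ⟨ζ, hζ, hle⟩ := h
  simp only [zero_le, Finset.filter_true] at hle
  set θ : Fin (T + 1) → Ω → Mat d := Function.update (fun _ _ => 0) t η with hθ
  have hθL : ∀ s, θ s ∈ L0 μ (𝒜 : Set (Mat d)) (ℋ s) := update_zero_mem_L0 hη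
  have hV : V (Fin.last T) (fun s => ev F s (θ s)) + V (Fin.last T) (fun s => ev F s (ζ s)) =
      fun ω => ∑ s, F s ω (θ s ω) + ∑ s, F s ω (ζ s ω) := by
    rw [V_last, V_last]
    funext ω
    simp [ev]
  have hmeas : ∀ θ : Fin (T + 1) → Ω → Mat d, (∀ s, θ s ∈ L0 μ (𝒜 : Set (Mat d)) (ℋ s)) →
      Measurable fun ω => ∑ s, F s ω (θ s ω) := fun θ hθ =>
    Finset.measurable_fun_sum _ fun s _ =>
      measurable_ev hF hA s ((hθ s).1.mono (ℋ.le s) le_rfl)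
  have := (hKP (fun s => ev F s (θ s)) (fun s => ev F s (ζ s)) (fun s => ev_mem_N (hθL s))
    (fun s => ev_mem_N (hζ s)) (by
      rw [hV]
      refine ⟨(hmeas θ hθL).add (hmeas ζ hζ), ?_⟩
      filter_upwards [hle, sum_ev_update_zero hF t η] with ω h1 h2
      rw [h2]
      exact neg_le_iff_add_nonneg'.1 h1)).1 t
  simpa [hθ] using this

theorem N0.smul (hF : IsTransferSequence μ 𝒜 F) {ξ : Ω → Vec d} (hξ : ξ ∈ N0 μ ℋ 𝒜 F t)
    {c : Ω → ℝ} (hc : Measurable[ℋ t] c) (hc0 : ∀ ω, 0 ≤ c ω) {ξ' : Ω → Vec d}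
    (h : ξ' =ᵐ[μ] fun ω => c ω • ξ ω) : ξ' ∈ N0 μ ℋ 𝒜 F t := by
  have key : ∀ ξ ∈ N μ ℋ 𝒜 F t, ∀ ξ', (ξ' =ᵐ[μ] fun ω => c ω • ξ ω) → ξ' ∈ N μ ℋ 𝒜 F t := by
    rintro ξ ⟨η, hη, h1⟩ ξ' h2
    refine ⟨_, smul_mem_L0 hc hc0 hη, ?_⟩
    filter_upwards [h1, h2, ev_smul (t := t) hF hc0 η] with ω h1 h2 h3
    rw [h2, h3, h1]
  refine ⟨key ξ hξ.1 ξ' h, key _ hξ.2 _ ?_⟩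
  filter_upwards [h] with ω h
  simp [h]

theorem nonempty_dualSet_of_KP [IsFiniteMeasure μ] [μ.IsComplete]
    (hF : IsTransferSequence μ 𝒜 F) (hA : HA μ 𝒜 F) (hint : IntegrableTransfers μ F)
    (hHN : HN0 μ ℋ 𝒜 F) (hKP : KP μ ℋ 𝒜 F) : (dualSet μ ℋ 𝒜 F).Nonempty := by
  obtain ⟨Z, hZ, hmax⟩ := exists_maximal_mem_unitPolar (ℋ := ℋ) hF hA hint
  have hZL : MemLp Z ∞ μ := unitPolar.memLp hZ
  refine ⟨Z, hZ.1, hZL, fun i => ?_, fun t η hη => ?_, fun t η hη => ?_⟩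
  · set B : Set Ω := {ω | Z ω i ≤ 0} with hB
    have hBm : MeasurableSet B :=
      measurableSet_le ((measurable_pi_apply i).comp hZ.1) measurable_const
    -- By maximality every element of the polar has nonpositive `i`-th component on `B`, so none
    -- separates `g` from the cone.
    set g : Ω → Vec d := B.indicator fun _ => Pi.single i 1 with hg
    have hgi : Integrable g μ := (integrable_const _).indicator hBm
    have hg0 : ∀ ω, 0 ≤ g ω := Set.indicator_nonneg fun _ _ => by simp
    have hmem : g ∈ attainableFrom μ ℋ 𝒜 F 0 := by
      by_contra hnot
      obtain ⟨Y, hY, hpos⟩ := exists_mem_unitPolar_attainableFrom hF hA hKP hHN hgi hnot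
      refine absurd hpos (not_lt.2 (integral_nonpos_of_ae ?_))
      filter_upwards [(hmax Y hY).1 i] with ω h
      by_cases hω : ω ∈ B
      · have : Y ω i ≤ 0 := by
          by_contra! hc
          exact absurd (h hc) (not_lt.2 hω)
        simpa [hg, hω] using this
      · simp [hg, hω]
    filter_upwards [eq_zero_of_mem_attainableFrom hKP hF hA hmem (Eventually.of_forall hg0)]
      with ω h
    by_contra! hcon
    have h1 := congrFun h i
    simp [hg, show ω ∈ B from hcon] at h1
  · filter_upwards [Fbar_eq_dualValue hF hA hint hZL hη.1,
      nonpos_of_mem_unitPolar hF hA hint hZ hη] with ω h1 h2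
    rw [h1]
    exact h2
  · set B : Set Ω := {ω | Fbar μ ℋ F t η Z ω = 0} with hB
    have hBm : MeasurableSet[ℋ t] B :=
      measurableSet_eq_fun ((measurable_condLExp _ _ _).ennreal_toReal.sub
        (measurable_condLExp _ _ _).ennreal_toReal) measurable_const
    have hw0 : ∀ ω, 0 ≤ B.indicator (1 : Ω → ℝ) ω := fun ω =>
      Set.indicator_nonneg (fun _ _ => zero_le_one) ω
    have hw1 : ∀ ω, B.indicator (1 : Ω → ℝ) ω ≤ 1 := fun ω =>
      Set.indicator_le_self' (fun _ _ => zero_le_one) ω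
    -- Normalising makes `F_t(θ)` integrable, as separation in `L¹` requires; the factor `1 + ‖η‖`
    -- is restored at the end.
    set θ : Ω → Mat d := fun ω => B.indicator (1 : Ω → ℝ) ω • (1 + ‖η ω‖)⁻¹ • η ω with hθ
    have hθL : θ ∈ L0 μ (𝒜 : Set (Mat d)) (ℋ t) :=
      smul_mem_L0 (measurable_indicator_one hBm) hw0
        (smul_mem_L0 (measurable_inv_one_add_norm hη.1) (fun ω => by positivity) hη)
    have hθb : ∀ ω, ‖θ ω‖ ≤ 1 := fun ω => by
      rw [hθ, norm_smul, Real.norm_of_nonneg (hw0 ω)]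
      exact mul_le_one₀ (hw1 ω) (norm_nonneg _) (norm_normalized_le _)
    have hθi : Integrable (ev F t θ) μ :=
      integrable_ev hA hint (hθL.1.mono (ℋ.le t) le_rfl) hθb
    have hZθ : ∀ᵐ ω ∂μ, dualValue μ ℋ F t Z ω (θ ω) = 0 := by
      filter_upwards [Fbar_eq_dualValue hF hA hint hZL hη.1] with ω h
      rw [hθ, dualValue_smul _ (hw0 ω), dualValue_smul _ (by positivity), ← h]
      by_cases hω : ω ∈ B
      · rw [show Fbar μ ℋ F t η Z ω = 0 from hω, mul_zero, mul_zero]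
      · rw [Set.indicator_of_notMem hω, zero_mul]
    -- If some `Y` had strictly negative value at `θ ω`, then `ω` would lie in the event of a ball
    -- around `θ ω`; maximality puts it in that of `Z`, whose value at `θ ω` is zero.
    have hYθ : ∀ Y ∈ unitPolar μ (attainableFrom μ ℋ 𝒜 F 0), ∫ ω, Y ω ⬝ᵥ ev F t θ ω ∂μ = 0 := by
      intro Y hY
      rw [← integral_condExp (ℋ.le t)]
      refine integral_eq_zero_of_ae ?_
      filter_upwards [condExp_dotProduct_ev hA hint (unitPolar.memLp hY) hθL.1 hθb, hZθ,
        nonpos_of_mem_unitPolar hF hA hint hY hθL, hθL.2,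
        ae_all_iff.2 fun q => ae_all_iff.2 fun k => (hmax Y hY).2 t q k] with ω h1 h2 h3 h4 h5
      rw [h1, Pi.zero_apply]
      refine le_antisymm h3 (not_lt.1 fun hlt => ?_)
      obtain ⟨q, k, hball, hω⟩ := exists_mem_negativeOnBall (𝒜 := 𝒜) hlt
      exact (dualValue_neg_of_mem_negativeOnBall (h5 q k hω) h4 hball).ne h2
    have hneg : (fun ω => -ev F t θ ω) ∈ attainableFrom μ ℋ 𝒜 F 0 := by
      by_contra hnot
      obtain ⟨Y, hY, hpos⟩ := exists_mem_unitPolar_attainableFrom hF hA hKP hHN hθi.neg hnot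
      simp only [Pi.neg_apply, dotProduct_neg, integral_neg, hYθ Y hY, neg_zero] at hpos
      exact lt_irrefl _ hpos
    refine N0.smul hF (ev_mem_N0_of_neg_mem_attainableFrom hF hA hKP hθL hneg)
      (measurable_one_add_norm hη.1) (fun ω => by positivity) ?_
    filter_upwards [ev_smul (t := t) hF (c := fun ω => 1 + ‖η ω‖) (fun ω => by positivity) θ,
      hF.transferMap t] with ω h1 h2
    rw [← h1]
    by_cases hω : ω ∈ B
    · simp only [hθ, ev, Set.indicator_of_mem hω, Pi.one_apply, one_smul,
        one_add_norm_smul_normalized]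
    · simp only [hθ, ev, Set.indicator_of_notMem hω, zero_smul, smul_zero]
      exact h2.map_zero.symm

theorem sum_eq_zero_of_isDual [IsFiniteMeasure μ] (hF : IsTransferSequence μ 𝒜 F)
    (hA : HA μ 𝒜 F) (hint : IntegrableTransfers μ F) {Z : Ω → Vec d} (hZ : IsDual μ ℋ 𝒜 F Z)
    {η : Fin (T + 1) → Ω → Mat d} (hη : ∀ t, η t ∈ L0 μ (𝒜 : Set (Mat d)) (ℋ t))
    (hpos : ∀ᵐ ω ∂μ, 0 ≤ ∑ t, F t ω (η t ω)) : ∀ᵐ ω ∂μ, ∑ t, F t ω (η t ω) = 0 := by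
  -- Clamping indices at `T` extends the dates to a monotone sequence of σ-algebras over `ℕ`.
  let φ : ℕ → Fin (T + 1) := fun n => ⟨min n T, by omega⟩
  have hφ : Monotone φ := fun a b hab => Fin.mk_le_mk.2 (min_le_min_right T hab)
  have hφt : ∀ t : Fin (T + 1), φ t.val = t := fun t =>
    Fin.ext (min_eq_left (Nat.lt_succ_iff.1 t.isLt))
  let θ : Fin (T + 1) → Ω → Mat d := fun t ω => (1 + ‖η t ω‖)⁻¹ • η t ω
  have hθ : ∀ t, θ t ∈ L0 μ (𝒜 : Set (Mat d)) (ℋ t) := fun t =>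
    smul_mem_L0 (measurable_inv_one_add_norm (hη t).1) (fun ω => by positivity) (hη t)
  have hθb : ∀ t ω, ‖θ t ω‖ ≤ 1 := fun t ω => norm_normalized_le _
  have hY : ∀ t, Integrable (fun ω => Z ω ⬝ᵥ ev F t (θ t) ω) μ := fun t =>
    integrable_dotProduct hZ.bounded
      (integrable_ev hA hint ((hθ t).1.mono (ℋ.le t) le_rfl) (hθb t))
  have hsum : ∀ᵐ ω ∂μ, ∑ n ∈ Finset.range (T + 1), (1 + ‖η (φ n) ω‖) *
      (Z ω ⬝ᵥ ev F (φ n) (θ (φ n)) ω) = Z ω ⬝ᵥ ∑ t, F t ω (η t ω) := by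
    filter_upwards [hF.ae_forall] with ω h
    rw [Finset.sum_range, dotProduct_sum]
    refine Finset.sum_congr rfl fun t _ => ?_
    rw [hφt, ← smul_eq_mul, ← dotProduct_smul, ev, ← (h t).homogeneous _ (by positivity),
      one_add_norm_smul_normalized]
  have hposi : ∀ᵐ ω ∂μ, ∀ i, 0 < Z ω i := ae_all_iff.2 hZ.pos
  have key := sum_eq_zero_of_condExp_nonpos (μ := μ) (m := fun n => ℋ (φ n))
    (fun a b hab => ℋ.mono (hφ hab)) (fun n => ℋ.le _) (T + 1)
    (fun n ω => 1 + ‖η (φ n) ω‖) (fun n ω => Z ω ⬝ᵥ ev F (φ n) (θ (φ n)) ω)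
    (fun n => measurable_one_add_norm (hη _).1) (fun n ω => by linarith [norm_nonneg (η (φ n) ω)])
    (fun n => hY _) (fun n => by
      filter_upwards [genCondExp_of_integrable (m := ℋ (φ n)) (hY (φ n)),
        hZ.nonpos (φ n) (θ (φ n)) (hθ _)] with ω h1 h2
      rw [← h1]
      exact h2) (by
      filter_upwards [hsum, hpos, hposi] with ω h1 h2 h3
      rw [h1]
      exact Finset.sum_nonneg fun i _ => mul_nonneg (h3 i).le (h2 i))
  filter_upwards [key, hsum, hpos, hposi] with ω h1 h2 h3 h4
  rw [h2] at h1
  funext i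
  have := (Finset.sum_eq_zero_iff_of_nonneg fun i _ => mul_nonneg (h4 i).le (h3 i)).1 h1 i
    (Finset.mem_univ i)
  exact (mul_eq_zero.1 this).resolve_left (h4 i).ne'

theorem NAw_of_nonempty_dualSet [IsFiniteMeasure μ] [μ.IsComplete]
    (hF : IsTransferSequence μ 𝒜 F) (hA : HA μ 𝒜 F) (hint : IntegrableTransfers μ F)
    (h : (dualSet μ ℋ 𝒜 F).Nonempty) : NAw μ ℋ 𝒜 F := by
  obtain ⟨Z, hZ⟩ := h
  refine Set.Subset.antisymm ?_ ?_
  · rintro g ⟨⟨ξ, hξ, r, hr, hg⟩, hgpos⟩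
    choose η hη hξη using hξ
    have hle : ∀ᵐ ω ∂μ, g ω ≤ ∑ t, F t ω (η t ω) := by
      filter_upwards [hg, hr.2, ae_all_iff.2 hξη] with ω h1 h2 h3
      rw [h1, V_last, Pi.sub_apply, Finset.sum_apply, Finset.sum_congr rfl fun t _ => h3 t]
      exact sub_le_self _ h2
    have hzero := sum_eq_zero_of_isDual hF hA hint hZ hη (by
      filter_upwards [hle, hgpos.2] with ω h1 h2 using le_trans h2 h1)
    filter_upwards [hle, hgpos.2, hzero] with ω h1 h2 h3
    exact le_antisymm (h1.trans h3.le) h2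
  · intro g hg
    refine ⟨⟨0, fun s => zero_mem_N hF s, 0, ⟨measurable_const, Eventually.of_forall fun _ =>
      le_refl (0 : Vec d)⟩, ?_⟩, measurable_const.congr_ae (EventuallyEq.symm hg), ?_⟩
    · filter_upwards [hg] with ω h
      rw [h, V_last]
      simp
    · filter_upwards [hg] with ω h
      exact h.ge

end Market

end FrictionMarket

theorem theorem2p1 {Ω : Type*} {mΩ : MeasurableSpace Ω} (μ : MeasureTheory.Measure Ω)
    [MeasureTheory.IsProbabilityMeasure μ] [μ.IsComplete] {d T : ℕ}
    (ℋ : MeasureTheory.Filtration (Fin (T + 1)) mΩ)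
    (𝒜 : ProperCone ℝ (FrictionMarket.Mat d))
    (F : Fin (T + 1) → Ω → FrictionMarket.Mat d → FrictionMarket.Vec d)
    (hF : FrictionMarket.IsTransferSequence μ 𝒜 F)
    (hA : FrictionMarket.HA μ 𝒜 F)
    (hint : FrictionMarket.IntegrableTransfers μ F) :
    ((FrictionMarket.dualSet μ ℋ 𝒜 F).Nonempty → FrictionMarket.NAw μ ℋ 𝒜 F) ∧
      (FrictionMarket.HN0 μ ℋ 𝒜 F → FrictionMarket.KP μ ℋ 𝒜 F →
        FrictionMarket.NAw μ ℋ 𝒜 F → (FrictionMarket.dualSet μ ℋ 𝒜 F).Nonempty) :=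
  ⟨FrictionMarket.NAw_of_nonempty_dualSet hF hA hint,
    fun hHN hKP _ => FrictionMarket.nonempty_dualSet_of_KP hF hA hint hHN hKP⟩
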